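/- Let $\mathbb R^{4,1}=\mathbb R^4\oplus\langle t_0\rangle$ carry the inner product $(\,,\,)$ of signature $++++-$ with $(t_0,t_0)=-1$, and let $\mathbb P(\mathcal L)$ be the set of null lines in $\mathbb R^{4,1}$, identified with the unit sphere $S^3\subset\mathbb R^4$ by $x\mapsto\langle x+t_0\rangle$; this is the conformal $3$-sphere. Let $\mathfrak g=\mathfrak{so}(4,1)$, identified with $\wedge^2\mathbb R^{4,1}$ by $(u\wedge v)w=(u,w)v-(v,w)u$. For a null line $\ell$, the subspace $\ell\wedge\ell^\perp\subset\mathfrak g$ is the abelian nilradical of the stabiliser of $\ell$. Let $\Sigma$ be an oriented smooth surface and $f:\Sigma\to\mathbb P(\mathcal L)=S^3$ a smooth immersion. Equip $\Sigma$ with the complex structure given by its orientation and the conformal structure induced by $f$. Let $\mathrm I$ be the induced metric, let $\mathrm{I\!I}_0$ be the trace-free part of the second fundamental form, and let $F=f+t_0:\Sigma\to\mathbb R^{4,1}$ be the corresponding lift of $f$ to the light cone. For a smooth symmetric $(2,0)$-form $q$ on $\Sigma$ let $Q$ be the $\mathrm I$-symmetric endomorphism of $T\Sigma$ with $q+\bar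 q=\mathrm I(Q\,\cdot,\cdot)$. Write $[q,\mathrm{I\!I}_0]=0$ if $Q$ commutes with the endomorphism that represents $\mathrm{I\!I}_0$ with respect to $\mathrm I$. Let $\eta_q$ be the $\mathfrak g$-valued $1$-form $$\eta_q(X)=-\tfrac16\,F\wedge \mathrm dF(QX).$$ This is $q+\bar q$, viewed as a $1$-form with values in $T^*\Sigma\subset f^{-1}T^*S^3\cong f\wedge f^\perp$; the last isomorphism is given by the Killing form. Call $f$ *isothermic* if there is a holomorphic quadratic differential $q$ on $\Sigma$, not identically zero, with $[q,\mathrm{I\!I}_0]=0$. Then: 1. $f$ is isothermic if and only if there is a smooth $\eta\in\Omega^1(\mathfrak g)$, not identically zero, such that $\mathrm d\eta=0$ and $\eta$ takes values in $f\wedge f^\perp$. 2. For each smooth symmetric $(2,0)$-form $q$ on $\Sigma$, the $1$-form $\eta_q$ is smooth and takes values in $f\wedge f^\perp$; moreover, $q$ is holomorphic with $[q,\mathrm{I\!I}_0]=0$ if and only if $\mathrm d\eta_q=0$. 3. Conversely, each smooth closed $\eta\in\Omega^1(\mathfrak g)$ with values in $f\wedge f^\perp$ is equal to $\eta_q$ for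 some smooth symmetric $(2,0)$-form $q$ on $\Sigma$. -/

import Mathlib

open scoped Manifold ContDiff

noncomputable section

namespace Isothermic

/-! ### Minkowski space, the projective light cone, and the Lie algebra `so(4,1)` -/

/-- The vector space `ℝ⁴ ⊕ ℝ t₀`, with `t₀ = (0, 1)`. -/
abbrev R41 : Type := EuclideanSpace ℝ (Fin 4) × ℝ

/-- The Minkowski inner product of signature `++++-`. -/
def mink : LinearMap.BilinForm ℝ R41 :=
  LinearMap.mk₂ ℝ (fun u v => inner ℝ u.1 v.1 - u.2 * v.2)
    (fun u u' v => by simp [inner_add_left]; ring)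
    (fun c u v => by simp [real_inner_smul_left]; ring)
    (fun u v v' => by simp [inner_add_right]; ring)
    (fun c u v => by simp [real_inner_smul_right]; ring)

theorem mink_apply (u v : R41) : mink u v = inner ℝ u.1 v.1 - u.2 * v.2 := rfl

theorem mink_comm (u v : R41) : mink u v = mink v u := by
  simp [mink_apply, real_inner_comm, mul_comm]

/-- The projective light cone `ℙ(𝓛)`: lines through zero all of whose vectors are null. -/
def ProjLightCone : Type :=
  {p : Projectivization ℝ R41 // ∀ v ∈ p.submodule, mink v v = 0}

/-- The line in Minkowski space that is the point `p`. -/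
def ProjLightCone.line (p : ProjLightCone) : Submodule ℝ R41 := p.1.submodule

/-- The orthogonal complement of a subspace for the Minkowski inner product. -/
def perp (W : Submodule ℝ R41) : Submodule ℝ R41 where
  carrier := {v | ∀ u ∈ W, mink u v = 0}
  add_mem' := fun ha hb u hu => by simp [ha u hu, hb u hu]
  zero_mem' := fun u _ => by simp
  smul_mem' := fun c v hv u hu => by simp [hv u hu]

/-- The vector on a null line with last coordinate `1`, i.e. the vector `x + t₀` with `x` in the
unit sphere of `ℝ⁴`. The map `p ↦ x` is the standard conformal diffeomorphism `ℙ(𝓛) ≅ S³`. -/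
def ProjLightCone.vec (p : ProjLightCone) : R41 := (p.1.rep.2)⁻¹ • p.1.rep

theorem ProjLightCone.rep_mem (p : ProjLightCone) : p.1.rep ∈ p.line := by
  rw [ProjLightCone.line, Projectivization.submodule_eq]
  exact Submodule.mem_span_singleton_self _

theorem ProjLightCone.vec_mem (p : ProjLightCone) : p.vec ∈ p.line :=
  p.line.smul_mem _ p.rep_mem

theorem ProjLightCone.vec_snd (p : ProjLightCone) : p.vec.2 = 1 := by
  have h0 : p.1.rep.2 ≠ 0 := by
    intro h
    have hn := p.2 _ p.rep_mem
    rw [mink_apply, h] at hn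
    have h1 : p.1.rep.1 = 0 := by simpa using hn
    exact p.1.rep_nonzero (Prod.ext h1 h)
  simp [ProjLightCone.vec, h0]

/-- The Lie algebra `𝔤 = so(4,1)` of skew endomorphisms of Minkowski space. -/
def so41 : Submodule ℝ (R41 →L[ℝ] R41) where
  carrier := {A | ∀ u v, mink (A u) v + mink u (A v) = 0}
  add_mem' := fun {A B} ha hb u v => by
    have h1 := ha u v
    have h2 := hb u v
    simp only [add_apply, map_add, LinearMap.add_apply]
    linarith
  zero_mem' := fun u v => by simp
  smul_mem' := fun c A hA u v => by
    have h1 := hA u v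
    simp only [smul_apply, map_smul, LinearMap.smul_apply, smul_eq_mul]
    rw [← mul_add, h1, mul_zero]

/-- `u ∧ v` as an endomorphism: `(u ∧ v) w = (u, w) v - (v, w) u`. -/
def wedgeEnd (u v : R41) : R41 →L[ℝ] R41 :=
  (LinearMap.toContinuousLinearMap (mink u)).smulRight v -
    (LinearMap.toContinuousLinearMap (mink v)).smulRight u

theorem wedgeEnd_apply (u v w : R41) : wedgeEnd u v w = mink u w • v - mink v w • u := rfl

/-- `u ∧ v` as an element of `so(4,1)`, linear in `v`. -/
def wedge (u : R41) : R41 →ₗ[ℝ] so41 where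
  toFun v := ⟨wedgeEnd u v, fun a b => by
    simp only [wedgeEnd_apply, map_sub, map_smul, LinearMap.sub_apply, LinearMap.smul_apply,
      smul_eq_mul]
    rw [mink_comm a v, mink_comm a u]
    ring⟩
  map_add' v v' := by
    apply Subtype.ext
    apply ContinuousLinearMap.ext
    intro w
    simp only [Submodule.coe_add, add_apply, wedgeEnd_apply, map_add, LinearMap.add_apply]
    module
  map_smul' c v := by
    apply Subtype.ext
    apply ContinuousLinearMap.ext
    intro w
    simp only [Submodule.coe_smul, smul_apply, wedgeEnd_apply, map_smul, LinearMap.smul_apply,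
      smul_eq_mul, RingHom.id_apply]
    module

/-- The subspace `ℓ ∧ ℓ^⊥` of `so(4,1)`, for a null line `ℓ`: the nilradical of the stabiliser
of `ℓ`. -/
def nilradical (p : ProjLightCone) : Submodule ℝ so41 :=
  Submodule.span ℝ {A | ∃ u ∈ p.line, ∃ v ∈ perp p.line, A = wedge u v}

/-- The element `-(1/6) F ∧ v` of `so(4,1)`, as a linear function of `v`. It represents the
cotangent vector `A ↦ (v, A F)` of `T_{[F]} ℙ(𝓛) ≅ 𝔤 / 𝔭` through the Killing form
`(A, B) ↦ 3 tr (A B)` of `so(4,1)`. -/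
def killingDual (F : R41) : R41 →ₗ[ℝ] so41 := wedge F ∘ₗ ((-(1 / 6 : ℝ)) • LinearMap.id)

theorem killingDual_spec (F v : R41) (A : so41) :
    3 * LinearMap.trace ℝ R41 ((A.1 : R41 →ₗ[ℝ] R41) ∘ₗ ((killingDual F v).1 : R41 →ₗ[ℝ] R41))
      = mink v (A.1 F) := by
  have h : ((A.1 : R41 →ₗ[ℝ] R41) ∘ₗ ((killingDual F v).1 : R41 →ₗ[ℝ] R41))
      = (-(1 / 6 : ℝ)) • ((mink F).smulRight (A.1 v) - (mink v).smulRight (A.1 F)) := by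
    apply LinearMap.ext
    intro w
    simp [killingDual, wedge, wedgeEnd_apply]
    module
  have h2 := A.2 F v
  rw [h, map_smul, map_sub, LinearMap.trace_smulRight, LinearMap.trace_smulRight,
    mink_comm v (A.1 F), smul_eq_mul]
  linarith

/-! ### Surfaces -/

/-- The endomorphism `A` with `g (A X, Y) = b (X, Y)`, for a nondegenerate form `g`. -/
def raise {T : Type*} [AddCommGroup T] [Module ℝ T] [FiniteDimensional ℝ T]
    (g b : LinearMap.BilinForm ℝ T) : T →ₗ[ℝ] T :=
  open Classical in
  if h : g.Nondegenerate then b.symmCompOfNondegenerate g h else 0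

theorem raise_spec {T : Type*} [AddCommGroup T] [Module ℝ T] [FiniteDimensional ℝ T]
    (g b : LinearMap.BilinForm ℝ T) (hg : g.Nondegenerate) (X Y : T) :
    g (raise g b X) Y = b X Y := by
  rw [raise, dif_pos hg]
  exact LinearMap.BilinForm.symmCompOfNondegenerate_left_apply b hg Y X

section Surface

variable {M : Type*} [TopologicalSpace M] [ChartedSpace (EuclideanSpace ℝ (Fin 2)) M]

/-- The tangent plane at a point of a surface. -/
abbrev Tan (x : M) : Type := TangentSpace (𝓡 2) x

instance finiteDimensional_tan (x : M) : FiniteDimensional ℝ (Tan x) :=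
  inferInstanceAs (FiniteDimensional ℝ (EuclideanSpace ℝ (Fin 2)))

/-- The derivative of a vector-valued function `g` at `x`. -/
def der {W : Type*} [NormedAddCommGroup W] [NormedSpace ℝ W] (g : M → W) (x : M) :
    Tan x →ₗ[ℝ] W :=
  (mfderiv (𝓡 2) 𝓘(ℝ, W) g x).toLinearMap

/-- Smoothness of a vector-valued function on a set. -/
def SmoothOn {W : Type*} [NormedAddCommGroup W] [NormedSpace ℝ W] (g : M → W) (U : Set M) : Prop :=
  ContMDiffOn (𝓡 2) 𝓘(ℝ, W) ∞ g U

/-- Smoothness of a vector field on a set. -/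
def SmoothField [IsManifold (𝓡 2) ∞ M] (X : ∀ x : M, Tan x) (U : Set M) : Prop :=
  ContMDiffOn (𝓡 2) (𝓡 2).tangent ∞ (fun x => (⟨x, X x⟩ : TangentBundle (𝓡 2) M)) U

/-- The pair `X, Y` is a basis in the orientation `o`. -/
def PositiveBasis {T : Type*} [AddCommGroup T] [Module ℝ T] (o : Orientation ℝ T (Fin 2))
    (X Y : T) : Prop :=
  ∃ b : Module.Basis (Fin 2) ℝ T, b 0 = X ∧ b 1 = Y ∧ b.orientation = o

variable (M) in
/-- An orientation of a surface: a choice of orientation of every tangent plane, such that there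
are positive smooth frames near every point. -/
structure SurfaceOrientation [IsManifold (𝓡 2) ∞ M] where
  /-- The orientation of the tangent plane at `x`. -/
  at_pt : ∀ x : M, Orientation ℝ (Tan x) (Fin 2)
  exists_frame : ∀ x : M, ∃ U : Set M, IsOpen U ∧ x ∈ U ∧ ∃ X Y : ∀ y : M, Tan y,
    SmoothField X U ∧ SmoothField Y U ∧ ∀ y ∈ U, PositiveBasis (at_pt y) (X y) (Y y)

/-! ### Differential forms with values in `so(4,1)` -/

variable (M) in
/-- One-forms with values in `so(4,1)`, not necessarily smooth. -/
abbrev OneForm : Type _ := ∀ x : M, Tan x →ₗ[ℝ] so41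

/-- A one-form is smooth if it takes smooth vector fields to smooth functions. -/
def OneForm.IsSmooth [IsManifold (𝓡 2) ∞ M] (η : OneForm M) : Prop :=
  ∀ (U : Set M) (X : ∀ x : M, Tan x), IsOpen U → SmoothField X U →
    SmoothOn (fun x => η x (X x)) U

/-- `dη = 0`, where `dη (X, Y) = X (η Y) - Y (η X) - η [X, Y]`. -/
def OneForm.IsClosed [IsManifold (𝓡 2) ∞ M] (η : OneForm M) : Prop :=
  ∀ (U : Set M) (X Y : ∀ x : M, Tan x), IsOpen U → SmoothField X U → SmoothField Y U → ∀ x ∈ U,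
    der (fun y => η y (Y y)) x (X x) - der (fun y => η y (X y)) x (Y x)
      - η x (VectorField.mlieBracket (𝓡 2) X Y x) = 0

/-- The one-form takes values in the bundle `f ∧ f^⊥`. -/
def OneForm.TakesValuesInNilradical (η : OneForm M) (f : M → ProjLightCone) : Prop :=
  ∀ (x : M) (X : Tan x), η x X ∈ nilradical (f x)

/-! ### Immersions into `S³ = ℙ(𝓛)` -/

/-- The lift `φ + t₀` of `f`, where `φ` is `f` viewed as a map to the unit sphere of `ℝ⁴`. -/
def lift (f : M → ProjLightCone) (x : M) : R41 := (f x).vec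

/-- A smooth immersion into `ℙ(𝓛) ≅ S³`. -/
def IsImmersion (f : M → ProjLightCone) : Prop :=
  SmoothOn (lift f) Set.univ ∧ ∀ x : M, Function.Injective (der (lift f) x)

/-- The metric `I (X, Y) = (dF X, dF Y)` induced on the surface by the lift `F = φ + t₀`. Its
conformal class is the one induced by the conformal structure of `ℙ(𝓛)`. -/
def firstForm (f : M → ProjLightCone) (x : M) : LinearMap.BilinForm ℝ (Tan x) :=
  mink.compl₁₂ (der (lift f) x) (der (lift f) x)

/-- `N` is on `U` a smooth unit normal field of `f` in the unit sphere of `ℝ⁴`. -/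
structure IsUnitNormal (f : M → ProjLightCone) (N : M → R41) (U : Set M) : Prop where
  smooth : SmoothOn N U
  tangent_sphere : ∀ x ∈ U, (N x).2 = 0 ∧ mink (N x) (lift f x) = 0
  normal : ∀ x ∈ U, ∀ X : Tan x, mink (N x) (der (lift f) x X) = 0
  unit : ∀ x ∈ U, mink (N x) (N x) = 1

/-- The second fundamental form `II (X, Y) = -(dN X, dF Y)`. -/
def secondForm (f : M → ProjLightCone) (N : M → R41) (x : M) : LinearMap.BilinForm ℝ (Tan x) :=
  -(mink.compl₁₂ (der N x) (der (lift f) x))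

/-- The trace-free part `II₀` of the second fundamental form. -/
def tracefreeSecondForm (f : M → ProjLightCone) (N : M → R41) (x : M) :
    LinearMap.BilinForm ℝ (Tan x) :=
  secondForm f N x
    - ((1 / 2 : ℝ) * LinearMap.trace ℝ (Tan x) (raise (firstForm f x) (secondForm f N x)))
      • firstForm f x

/-! ### Quadratic differentials -/

variable (M) in
/-- Complex-valued real-bilinear forms on the tangent planes. -/
abbrev BilinField : Type _ := ∀ x : M, Tan x →ₗ[ℝ] Tan x →ₗ[ℝ] ℂ

/-- `X, Y` is a positively oriented conformal frame for the induced conformal structure, i.e.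
`X ≠ 0` and `Y = J X`, where `J` is the rotation by a right angle. -/
def IsConformalPair [IsManifold (𝓡 2) ∞ M] (o : SurfaceOrientation M) (f : M → ProjLightCone)
    (x : M) (X Y : Tan x) : Prop :=
  PositiveBasis (o.at_pt x) X Y ∧ firstForm f x X X = firstForm f x Y Y ∧ firstForm f x X Y = 0

/-- `q` is a (smooth) symmetric `(2,0)`-form for the complex structure `J` that is given by the
orientation and the induced conformal structure: `q (J X, Z) = i q (X, Z)`. -/
structure IsQuadraticDifferential [IsManifold (𝓡 2) ∞ M] (o : SurfaceOrientation M)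
    (f : M → ProjLightCone) (q : BilinField M) : Prop where
  smooth : ∀ (U : Set M) (X Y : ∀ x : M, Tan x), IsOpen U → SmoothField X U → SmoothField Y U →
    SmoothOn (fun x => q x (X x) (Y x)) U
  symm : ∀ (x : M) (X Y : Tan x), q x X Y = q x Y X
  type_two_zero : ∀ (x : M) (X Y : Tan x), IsConformalPair o f x X Y →
    ∀ Z : Tan x, q x Y Z = Complex.I * q x X Z

/-- `q` is holomorphic: `∂̄ q = 0`. For a local vector field `Z = X - i Y` of type `(1,0)`, with
`Y = J X`, the Cauchy-Riemann operator is `(∂̄_Z̄ q) (Z, Z) = Z̄ (q (Z, Z)) - 2 q ([Z̄, Z], Z)`, which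
for a `(2,0)`-form `q` is four times the expression below. If `X = ∂/∂x` and `Y = ∂/∂y` for a
holomorphic coordinate `x + i y`, so that `[X, Y] = 0` and `q = h (dx + i dy)²` with
`h = q (X, X)`, this is the Cauchy-Riemann equation `h_x + i h_y = 0`. -/
def IsHolomorphic [IsManifold (𝓡 2) ∞ M] (o : SurfaceOrientation M)
    (f : M → ProjLightCone) (q : BilinField M) : Prop :=
  ∀ (U : Set M) (X Y : ∀ x : M, Tan x), IsOpen U → SmoothField X U → SmoothField Y U →
    (∀ x ∈ U, IsConformalPair o f x (X x) (Y x)) → ∀ x ∈ U,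
      der (fun y => q y (X y) (X y)) x (X x) + Complex.I * der (fun y => q y (X y) (X y)) x (Y x)
        + 2 * Complex.I * q x (VectorField.mlieBracket (𝓡 2) X Y x) (X x) = 0

/-- The real symmetric form `q + q̄`. -/
def realForm (q : BilinField M) (x : M) : LinearMap.BilinForm ℝ (Tan x) :=
  (2 : ℝ) • (q x).compr₂ Complex.reLm

/-- The endomorphism `Q` with `q + q̄ = I (Q · , ·)`. -/
def quadEnd (f : M → ProjLightCone) (q : BilinField M) (x : M) : Tan x →ₗ[ℝ] Tan x :=
  raise (firstForm f x) (realForm q x)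

/-- `[q, II₀] = 0`: the symmetric endomorphisms that represent `q + q̄` and `II₀` commute. -/
def CommutesWithSecondForm (f : M → ProjLightCone) (q : BilinField M) : Prop :=
  ∀ (U : Set M) (N : M → R41), IsOpen U → IsUnitNormal f N U → ∀ x ∈ U,
    quadEnd f q x ∘ₗ raise (firstForm f x) (tracefreeSecondForm f N x)
      = raise (firstForm f x) (tracefreeSecondForm f N x) ∘ₗ quadEnd f q x

/-- `f` is isothermic: there is a nonzero holomorphic quadratic differential that commutes with
the second fundamental form. -/
def IsIsothermic [IsManifold (𝓡 2) ∞ M] (o : SurfaceOrientation M) (f : M → ProjLightCone) :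
    Prop :=
  ∃ q : BilinField M, IsQuadraticDifferential o f q ∧ (∃ x, q x ≠ 0) ∧
    IsHolomorphic o f q ∧ CommutesWithSecondForm f q

/-- The `so(4,1)`-valued one-form `η` given by `q + q̄`, viewed as a one-form with values in
`T*Σ ⊆ f⁻¹ T*S³ ≅ f ∧ f^⊥`. Here `(q + q̄) (X, · ) = (dF (Q X), dF · )` becomes the cotangent
vector `A ↦ (dF (Q X), A F)` of `S³`, which vanishes on the normal of `f`. The result does not
depend on the choice of the lift `F`. -/
def associatedForm (f : M → ProjLightCone) (q : BilinField M) : OneForm M := fun x =>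
  killingDual (lift f x) ∘ₗ der (lift f) x ∘ₗ quadEnd f q x

end Surface

end Isothermic

end

/-! Write `η_q = F ∧ ω` with `ω = -(1/6) dF ∘ Q`. Then `dη_q` is the sum of `dF ∧ ω`, that is `dF(X)
∧ ω(Y) - dF(Y) ∧ ω(X)`, and `F ∧ dω`. The first summand is a multiple of `tr Q`, which vanishes
because `q` has type (2,0). Since `dω` has last coordinate zero and `F` has last coordinate one, `F
∧ dω = 0` exactly when `dω = 0`. So `dη_q = 0` if and only if the `ℝ⁴`-valued 2-form `d(dF ∘ Q)`
vanishes (`extDer_associatedForm`, `eq_zero_of_wedge_eq_zero`).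

This 2-form is tested on the orthogonal frame `F - t₀, dF(X), dF(Y), N` of `ℝ⁴`, for a conformal
frame `X, Y` and a unit normal `N`. The component along `F - t₀` vanishes since `q` is symmetric
(`mink_lift_extDer`). The two tangential components are the imaginary and the real part of the
Cauchy-Riemann operator of `q`, up to a factor `-2` (`mink_extDer_quadForm`). The normal component
is `II(X, QY) - II(Y, QX)`, which vanishes exactly when `Q` commutes with `II₀` (`commute_iff`).
This proves the second claim.

Conversely, a form `η` with values in `f ∧ f^⊥` is `F ∧ ω` for a unique `ω` orthogonal to `F` and
`t₀`, namely `ω = -η t₀`. As `t₀` is constant, `dη = 0` gives `dω = 0`, and then also `dF ∧ ω = 0`.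
The second equation is algebraic: it makes `ω` tangential and trace-free. The `F`-component of `dω =
0` makes it symmetric (`pairing_spec`). A symmetric trace-free form is the real part of a unique
(2,0)-form, so `η = η_q`. The first claim follows because `q` and `η_q` vanish at the same points.
-/

noncomputable section

namespace Isothermic

section Calculus

variable {M : Type*} [TopologicalSpace M] [ChartedSpace (EuclideanSpace ℝ (Fin 2)) M]
  {W W₁ W₂ : Type*} [NormedAddCommGroup W] [NormedSpace ℝ W]
  [NormedAddCommGroup W₁] [NormedSpace ℝ W₁] [NormedAddCommGroup W₂] [NormedSpace ℝ W₂]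

/-! ### Calculus of vector-valued functions on a surface -/

/-- Differentiability at a point of a vector-valued function on a surface. -/
abbrev DiffAt (g : M → W) (x : M) : Prop := MDifferentiableAt (𝓡 2) 𝓘(ℝ, W) g x

theorem SmoothOn.diffAt {g : M → W} {U : Set M} (hg : SmoothOn g U) (hU : IsOpen U) {x : M}
    (hx : x ∈ U) : DiffAt g x :=
  ((hg x hx).contMDiffAt (hU.mem_nhds hx)).mdifferentiableAt (by simp)

theorem SmoothOn.mono {g : M → W} {U V : Set M} (hg : SmoothOn g U) (h : V ⊆ U) : SmoothOn g V :=
  ContMDiffOn.mono hg h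

theorem SmoothOn.congr {g h : M → W} {U : Set M} (hg : SmoothOn g U) (e : ∀ y ∈ U, h y = g y) :
    SmoothOn h U :=
  ContMDiffOn.congr hg e

theorem smoothOn_of_forall_exists {g : M → W} {U : Set M}
    (h : ∀ x ∈ U, ∃ V : Set M, IsOpen V ∧ x ∈ V ∧ SmoothOn g V) : SmoothOn g U := by
  intro x hx
  obtain ⟨V, hV, hxV, hg⟩ := h x hx
  exact ((hg x hxV).contMDiffAt (hV.mem_nhds hxV)).contMDiffWithinAt

theorem SmoothOn.clm (L : W₁ →L[ℝ] W) {g : M → W₁} {U : Set M} (hg : SmoothOn g U) :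
    SmoothOn (fun y => L (g y)) U :=
  L.contMDiff.comp_contMDiffOn hg

theorem SmoothOn.bilin (β : W₁ →L[ℝ] W₂ →L[ℝ] W) {g : M → W₁} {h : M → W₂} {U : Set M}
    (hg : SmoothOn g U) (hh : SmoothOn h U) : SmoothOn (fun y => β (g y) (h y)) U :=
  ContMDiffOn.clm_apply (SmoothOn.clm β hg) hh

theorem SmoothOn.add {g h : M → W} {U : Set M} (hg : SmoothOn g U) (hh : SmoothOn h U) :
    SmoothOn (fun y => g y + h y) U :=
  ContMDiffOn.add hg hh

theorem SmoothOn.sub {g h : M → W} {U : Set M} (hg : SmoothOn g U) (hh : SmoothOn h U) :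
    SmoothOn (fun y => g y - h y) U :=
  ContMDiffOn.sub hg hh

theorem SmoothOn.smul {a : M → ℝ} {h : M → W} {U : Set M} (ha : SmoothOn a U)
    (hh : SmoothOn h U) : SmoothOn (fun y => a y • h y) U :=
  ContMDiffOn.smul ha hh

theorem smoothOn_const (c : W) (U : Set M) : SmoothOn (fun _ : M => c) U := contMDiffOn_const

theorem SmoothOn.comp_contDiffAt {φ : W₁ → W} {g : M → W₁} {U : Set M} (hg : SmoothOn g U)
    (hφ : ∀ y ∈ U, ContDiffAt ℝ ∞ φ (g y)) : SmoothOn (fun y => φ (g y)) U :=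
  fun y hy => (hφ y hy).comp_contMDiffWithinAt (hg y hy)

theorem SmoothOn.mul {a b : M → ℝ} {U : Set M} (ha : SmoothOn a U) (hb : SmoothOn b U) :
    SmoothOn (fun x => a x * b x) U := SmoothOn.smul ha hb

theorem SmoothOn.inv {a : M → ℝ} {U : Set M} (ha : SmoothOn a U) (h : ∀ x ∈ U, a x ≠ 0) :
    SmoothOn (fun x => (a x)⁻¹) U :=
  ha.comp_contDiffAt fun y hy => contDiffAt_inv ℝ (h y hy)

theorem SmoothOn.div {a b : M → ℝ} {U : Set M} (ha : SmoothOn a U) (hb : SmoothOn b U)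
    (h : ∀ x ∈ U, b x ≠ 0) : SmoothOn (fun x => a x / b x) U :=
  (ha.mul (hb.inv h)).congr fun _ _ => div_eq_mul_inv _ _

theorem SmoothOn.sqrt {a : M → ℝ} {U : Set M} (ha : SmoothOn a U) (h : ∀ x ∈ U, 0 < a x) :
    SmoothOn (fun x => √(a x)) U :=
  ha.comp_contDiffAt fun y hy => Real.contDiffAt_sqrt (h y hy).ne'

theorem der_apply (g : M → W) (x : M) (v : Tan x) :
    der g x v = mfderiv (𝓡 2) 𝓘(ℝ, W) g x v := rfl

theorem HasMFDerivAt.der_eq {g : M → W} {x : M} {g' : Tan x →L[ℝ] W}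
    (h : HasMFDerivAt (𝓡 2) 𝓘(ℝ, W) g x g') (v : Tan x) : der g x v = g' v := by
  rw [der_apply, h.mfderiv]; rfl

theorem der_congr {g h : M → W} {U : Set M} (hU : IsOpen U) {x : M} (hx : x ∈ U)
    (e : ∀ y ∈ U, g y = h y) (v : Tan x) : der g x v = der h x v := by
  have : g =ᶠ[nhds x] h := Filter.eventuallyEq_of_mem (hU.mem_nhds hx) e
  rw [der_apply, der_apply, this.mfderiv_eq]; rfl

theorem der_const (c : W) (x : M) (v : Tan x) : der (fun _ : M => c) x v = 0 := by
  rw [der_apply, mfderiv_const]; rfl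

theorem DiffAt.clm (L : W₁ →L[ℝ] W) {g : M → W₁} {x : M} (hg : DiffAt g x) :
    DiffAt (fun y => L (g y)) x :=
  (L.hasMFDerivAt.comp x hg.hasMFDerivAt).mdifferentiableAt

theorem der_clm (L : W₁ →L[ℝ] W) {g : M → W₁} {x : M} (hg : DiffAt g x) (v : Tan x) :
    der (fun y => L (g y)) x v = L (der g x v) :=
  HasMFDerivAt.der_eq (L.hasMFDerivAt.comp x hg.hasMFDerivAt) v

theorem hasMFDerivAt_bilin (β : W₁ →L[ℝ] W₂ →L[ℝ] W) {g : M → W₁} {h : M → W₂} {x : M}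
    (hg : DiffAt g x) (hh : DiffAt h x) :
    HasMFDerivAt (𝓡 2) 𝓘(ℝ, W) (fun y => β (g y) (h y)) x
      ((β.deriv₂ (g x, h x)).comp ((mfderiv (𝓡 2) 𝓘(ℝ, W₁) g x).prod
        (mfderiv (𝓡 2) 𝓘(ℝ, W₂) h x))) :=
  HasMFDerivAt.comp (I' := 𝓘(ℝ, W₁ × W₂)) x
    ((β.isBoundedBilinearMap.hasFDerivAt (g x, h x)).hasMFDerivAt)
    ⟨(MDifferentiableAt.hasMFDerivAt hg).1.prodMk (MDifferentiableAt.hasMFDerivAt hh).1,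
      (MDifferentiableAt.hasMFDerivAt hg).2.prodMk (MDifferentiableAt.hasMFDerivAt hh).2⟩

theorem der_bilin (β : W₁ →L[ℝ] W₂ →L[ℝ] W) {g : M → W₁} {h : M → W₂} {x : M}
    (hg : DiffAt g x) (hh : DiffAt h x) (v : Tan x) :
    der (fun y => β (g y) (h y)) x v = β (der g x v) (h x) + β (g x) (der h x v) := by
  rw [HasMFDerivAt.der_eq (hasMFDerivAt_bilin β hg hh), add_comm]
  rfl

theorem DiffAt.bilin (β : W₁ →L[ℝ] W₂ →L[ℝ] W) {g : M → W₁} {h : M → W₂} {x : M}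
    (hg : DiffAt g x) (hh : DiffAt h x) : DiffAt (fun y => β (g y) (h y)) x :=
  (hasMFDerivAt_bilin β hg hh).mdifferentiableAt

theorem der_smul {a : M → ℝ} {h : M → W} {x : M} (ha : DiffAt a x) (hh : DiffAt h x)
    (v : Tan x) :
    der (fun y => a y • h y) x v = der a x v • h x + a x • der h x v :=
  der_bilin (ContinuousLinearMap.lsmul ℝ ℝ) ha hh v

theorem DiffAt.smul {a : M → ℝ} {h : M → W} {x : M} (ha : DiffAt a x) (hh : DiffAt h x) :
    DiffAt (fun y => a y • h y) x :=
  DiffAt.bilin (ContinuousLinearMap.lsmul ℝ ℝ) ha hh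

theorem der_add {g h : M → W} {x : M} (hg : DiffAt g x) (hh : DiffAt h x) (v : Tan x) :
    der (fun y => g y + h y) x v = der g x v + der h x v :=
  HasMFDerivAt.der_eq (hg.hasMFDerivAt.add hh.hasMFDerivAt) v

variable [IsManifold (𝓡 2) ∞ M]

theorem SmoothField.mono {X : ∀ x : M, Tan x} {U V : Set M} (hX : SmoothField X U) (h : V ⊆ U) :
    SmoothField X V :=
  ContMDiffOn.mono hX h

theorem SmoothField.add {X Y : ∀ x : M, Tan x} {U : Set M} (hX : SmoothField X U)
    (hY : SmoothField Y U) : SmoothField (fun x => X x + Y x) U :=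
  have : IsManifold (𝓡 2) (∞ + 1) M := by simpa using ‹IsManifold (𝓡 2) ∞ M›
  ContMDiffOn.add_section hX hY

theorem SmoothField.smul {a : M → ℝ} {X : ∀ x : M, Tan x} {U : Set M} (ha : SmoothOn a U)
    (hX : SmoothField X U) : SmoothField (fun x => a x • X x) U :=
  have : IsManifold (𝓡 2) (∞ + 1) M := by simpa using ‹IsManifold (𝓡 2) ∞ M›
  ContMDiffOn.smul_section ha hX

theorem SmoothOn.der {g : M → W} {X : ∀ x : M, Tan x} {U : Set M} (hU : IsOpen U)
    (hg : SmoothOn g U) (hX : SmoothField X U) : SmoothOn (fun x => der g x (X x)) U := by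
  have : IsManifold (𝓡 2) 1 M := IsManifold.of_le (n := ∞) (by simp)
  have h1 := ContMDiffOn.contMDiffOn_tangentMapWithin (m := ∞) hg (by simp) hU.uniqueMDiffOn
  have h2 := (contMDiff_snd_tangentBundle_modelSpace W 𝓘(ℝ, W) (n := ∞)).comp_contMDiffOn
    (h1.comp hX (fun x hx => hx))
  refine SmoothOn.congr h2 fun y hy => ?_
  change mfderiv (𝓡 2) 𝓘(ℝ, W) g y (X y) = mfderivWithin (𝓡 2) 𝓘(ℝ, W) g U y (X y)
  rw [mfderivWithin_of_isOpen hU hy]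

theorem mfderiv_eq_fderiv_comp_extChartAt {g : M → W} {x y : M}
    (hy : y ∈ (extChartAt (𝓡 2) x).source) (hg : DiffAt g y) (v : Tan y) :
    DifferentiableAt ℝ (g ∘ (extChartAt (𝓡 2) x).symm) (extChartAt (𝓡 2) x y) ∧
    Isothermic.der g y v = fderiv ℝ (g ∘ (extChartAt (𝓡 2) x).symm) (extChartAt (𝓡 2) x y)
      (mfderiv (𝓡 2) 𝓘(ℝ, EuclideanSpace ℝ (Fin 2)) (extChartAt (𝓡 2) x) y v) := by
  have : IsManifold (𝓡 2) 1 M := IsManifold.of_le (n := ∞) (by simp)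
  set φ := extChartAt (𝓡 2) x with hφ
  have hl : φ.symm (φ y) = y := φ.left_inv hy
  have hs : MDifferentiableAt 𝓘(ℝ, EuclideanSpace ℝ (Fin 2)) (𝓡 2) φ.symm (φ y) := by
    have := mdifferentiableWithinAt_extChartAt_symm (I := 𝓡 2) (x := x) (φ.map_source hy)
    rwa [(𝓡 2).range_eq_univ, mdifferentiableWithinAt_univ] at this
  have hG : MDifferentiableAt 𝓘(ℝ, EuclideanSpace ℝ (Fin 2)) 𝓘(ℝ, W) (g ∘ φ.symm) (φ y) := by
    refine MDifferentiableAt.comp (I' := 𝓡 2) (φ y) ?_ hs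
    rw [hl]; exact hg
  have hG' := hG.differentiableAt
  refine ⟨hG', ?_⟩
  have hφd : MDifferentiableAt (𝓡 2) 𝓘(ℝ, EuclideanSpace ℝ (Fin 2)) φ y :=
    mdifferentiableAt_extChartAt (by simpa [hφ] using hy)
  have e : g =ᶠ[nhds y] (g ∘ φ.symm) ∘ φ := by
    filter_upwards [(isOpen_extChartAt_source (I := 𝓡 2) x).mem_nhds hy] with z hz
    simp only [Function.comp_apply]
    rw [φ.left_inv hz]
  rw [der_apply, e.mfderiv_eq, mfderiv_comp y hG hφd, mfderiv_eq_fderiv]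
  rfl

/-- In a chart the iterated derivative of `G` along two fields is a second-derivative term plus `DG`
applied to the derivative of one field along the other. The second derivative is symmetric, so only
the coordinate bracket survives. Applied to the lift `F`, this identity `d(dF) = 0` gives the
symmetry of `II`, the torsion-freeness behind the Cauchy-Riemann computation, and the bracket of
recombined vector fields. -/
theorem der_der_sub {g : M → W} {X Y : ∀ x : M, Tan x} {U : Set M} (hU : IsOpen U)
    (hg : SmoothOn g U) (hX : SmoothField X U) (hY : SmoothField Y U) {x : M} (hx : x ∈ U) :
    Isothermic.der (fun y => Isothermic.der g y (Y y)) x (X x)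
      - Isothermic.der (fun y => Isothermic.der g y (X y)) x (Y x)
      = Isothermic.der g x (VectorField.mlieBracket (𝓡 2) X Y x) := by
  have : IsManifold (𝓡 2) 1 M := IsManifold.of_le (n := ∞) (by simp)
  have : IsManifold (𝓡 2) 2 M := IsManifold.of_le (n := ∞) (by norm_cast)
  let E := EuclideanSpace ℝ (Fin 2)
  set φ := extChartAt (𝓡 2) x with hφ
  let G : E → W := g ∘ φ.symm
  have hxs : x ∈ φ.source := mem_extChartAt_source x
  -- chart expression of a vector field
  let P : (∀ x : M, Tan x) → E → E := fun Z =>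
    VectorField.mpullbackWithin 𝓘(ℝ, E) (𝓡 2) φ.symm Z (Set.range (𝓡 2))
  have hP : ∀ Z : ∀ x : M, Tan x, SmoothField Z U → DifferentiableAt ℝ (P Z) (φ x) := by
    intro Z hZ
    have h1 : MDifferentiableWithinAt (𝓡 2) (𝓡 2).tangent
        (fun x => (⟨x, Z x⟩ : TangentBundle (𝓡 2) M)) Set.univ x :=
      (((hZ x hx).contMDiffAt (hU.mem_nhds hx)).mdifferentiableAt
        (by simp)).mdifferentiableWithinAt
    have := MDifferentiableWithinAt.differentiableWithinAt_mpullbackWithin_vectorField h1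
    rw [Set.preimage_univ, Set.univ_inter] at this
    exact this.differentiableAt (by simp)
  have hinv : ∀ y ∈ φ.source, ∀ w : E, mfderiv (𝓡 2) 𝓘(ℝ, E) φ y
      ((mfderiv (𝓡 2) 𝓘(ℝ, E) φ y).inverse w) = w := by
    intro y hy w
    obtain ⟨e, he⟩ := isInvertible_mfderiv_extChartAt (I := 𝓡 2) hy
    rw [← he, ContinuousLinearMap.inverse_equiv]
    exact e.apply_symm_apply w
  have hPe : ∀ Z : ∀ x : M, Tan x, ∀ᶠ y in nhds x,
      mfderiv (𝓡 2) 𝓘(ℝ, E) φ y (Z y) = P Z (φ y) := by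
    intro Z
    have h1 := VectorField.eventuallyEq_mpullback_mpullbackWithin_extChartAt (I := 𝓡 2)
      (s := Set.univ) (x := x) Z
    rw [nhdsWithin_univ] at h1
    filter_upwards [h1, (isOpen_extChartAt_source (I := 𝓡 2) x).mem_nhds hxs] with y hy hys
    rw [hy, VectorField.mpullback_apply]
    exact hinv y hys _
  have hG : ContDiffAt ℝ ∞ G (φ x) := by
    have h1 : ContMDiffAt 𝓘(ℝ, E) (𝓡 2) ∞ φ.symm (φ x) := by
      have := contMDiffWithinAt_extChartAt_symm_range_self (I := 𝓡 2) (n := ∞) x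
      rwa [(𝓡 2).range_eq_univ, contMDiffWithinAt_univ] at this
    have h2 : ContMDiffAt (𝓡 2) 𝓘(ℝ, W) ∞ g (φ.symm (φ x)) := by
      rw [φ.left_inv hxs]
      exact (hg x hx).contMDiffAt (hU.mem_nhds hx)
    exact (h2.comp (φ x) h1).contDiffAt
  have hdG : DifferentiableAt ℝ (fderiv ℝ G) (φ x) :=
    ((hG.fderiv_right (m := 1) (by norm_cast)).differentiableAt (by simp))
  have hφd : MDifferentiableAt (𝓡 2) 𝓘(ℝ, E) φ x :=
    mdifferentiableAt_extChartAt (by simp)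
  have key : ∀ Z T : ∀ x : M, Tan x, SmoothField Z U →
      Isothermic.der (fun y => Isothermic.der g y (Z y)) x (T x)
        = fderiv ℝ (fderiv ℝ G) (φ x) (P T (φ x)) (P Z (φ x))
          + fderiv ℝ G (φ x) (fderiv ℝ (P Z) (φ x) (P T (φ x))) := by
    intro Z T hZ
    have e : (fun y => Isothermic.der g y (Z y)) =ᶠ[nhds x]
        (fun p => fderiv ℝ G p (P Z p)) ∘ φ := by
      filter_upwards [hPe Z, (isOpen_extChartAt_source (I := 𝓡 2) x).mem_nhds hxs,
        hU.mem_nhds hx] with y hy hys hyU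
      rw [(mfderiv_eq_fderiv_comp_extChartAt (x := x) hys (hg.diffAt hU hyU) (Z y)).2, ← hφ, hy]
      rfl
    have hd : DifferentiableAt ℝ (fun p => fderiv ℝ G p (P Z p)) (φ x) := hdG.clm_apply (hP Z hZ)
    rw [der_apply, e.mfderiv_eq, mfderiv_comp x hd.mdifferentiableAt hφd, mfderiv_eq_fderiv]
    have h3 := (hPe T).self_of_nhds
    change fderiv ℝ (fun p => fderiv ℝ G p (P Z p)) (φ x) (mfderiv (𝓡 2) 𝓘(ℝ, E) φ x (T x)) = _
    rw [h3, fderiv_clm_apply hdG (hP Z hZ)]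
    rw [add_comm]
    rfl
  have hsymm : IsSymmSndFDerivAt ℝ G (φ x) := hG.isSymmSndFDerivAt (by simp; norm_cast)
  rw [key Y X hY, key X Y hX,
    (mfderiv_eq_fderiv_comp_extChartAt (x := x) hxs (hg.diffAt hU hx) _).2, ← hφ,
    ← VectorField.mlieBracketWithin_univ, VectorField.mlieBracketWithin_apply, ← hφ]
  have h6 : φ.symm ⁻¹' Set.univ ∩ Set.range (𝓡 2) = Set.univ := by simp
  have h7 : VectorField.lieBracketWithin ℝ (P X) (P Y) Set.univ (φ x)
      = fderiv ℝ (P Y) (φ x) (P X (φ x)) - fderiv ℝ (P X) (φ x) (P Y (φ x)) := by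
    rw [VectorField.lieBracketWithin_univ]; rfl
  rw [hinv x hxs, h6, hsymm.eq (P X (φ x)) (P Y (φ x))]
  change _ = fderiv ℝ G (φ x) (VectorField.lieBracketWithin ℝ (P X) (P Y) Set.univ (φ x))
  rw [h7, map_sub]
  abel

end Calculus

/-! ### Minkowski space -/

/-- The Minkowski inner product as a continuous bilinear map. -/
def minkL : R41 →L[ℝ] R41 →L[ℝ] ℝ := LinearMap.toContinuousBilinearMap mink

theorem wedge_apply (u v w : R41) : (wedge u v).1 w = mink u w • v - mink v w • u := rfl

set_option synthInstance.maxHeartbeats 400000 in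
instance : ContinuousConstSMul ℝ so41 := inferInstance

instance : NormedAddCommGroup so41 := inferInstance

instance : NormedSpace ℝ so41 := inferInstance

instance : AddCommGroup so41 := inferInstance

/-- The wedge product as a continuous bilinear map. -/
def wedgeL : R41 →L[ℝ] R41 →L[ℝ] so41 :=
  LinearMap.toContinuousBilinearMap <| LinearMap.mk₂ ℝ (fun u v => wedge u v)
    (fun u u' v => by
      apply Subtype.ext; apply ContinuousLinearMap.ext; intro w
      simp only [Submodule.coe_add, add_apply, wedge_apply, map_add, LinearMap.add_apply]
      module)
    (fun c u v => by
      apply Subtype.ext; apply ContinuousLinearMap.ext; intro w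
      simp only [Submodule.coe_smul, smul_apply, wedge_apply, map_smul, LinearMap.smul_apply,
        smul_eq_mul]
      module)
    (fun u v v' => map_add _ _ _) (fun c u v => map_smul _ _ _)

theorem wedgeL_apply (u v : R41) : wedgeL u v = wedge u v := rfl

/-- The time-like unit vector `t₀`. -/
def t0 : R41 := (0, 1)

theorem mink_t0 (v : R41) : mink v t0 = -v.2 := by
  simp [mink_apply, t0]

/-- Evaluation of elements of `so(4,1)` at a vector. -/
def evalL (v : R41) : so41 →L[ℝ] R41 :=
  (ContinuousLinearMap.apply ℝ R41 v).comp so41.subtypeL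

theorem mink_self_pos {v : R41} (h2 : v.2 = 0) (h : v ≠ 0) : 0 < mink v v := by
  have h1 : v.1 ≠ 0 := fun h1 => h (Prod.ext h1 h2)
  rw [mink_apply, h2, mul_zero, sub_zero, real_inner_self_eq_norm_sq]
  positivity

/-- A space-like hyperplane of Minkowski space contains at most four nonzero orthogonal vectors. -/
theorem eq_zero_of_orthogonal {a b c d v : R41} (ha : a.2 = 0) (hb : b.2 = 0) (hc : c.2 = 0)
    (hd : d.2 = 0) (hv : v.2 = 0) (ha0 : a ≠ 0) (hb0 : b ≠ 0) (hc0 : c ≠ 0) (hd0 : d ≠ 0)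
    (hab : mink a b = 0) (hac : mink a c = 0) (had : mink a d = 0) (hbc : mink b c = 0)
    (hbd : mink b d = 0) (hcd : mink c d = 0) (hva : mink v a = 0) (hvb : mink v b = 0)
    (hvc : mink v c = 0) (hvd : mink v d = 0) : v = 0 := by
  by_contra hv0
  have key : ∀ p : R41, p.2 = 0 → p ≠ 0 → p.1 ≠ 0 := fun p h2 h0 h1 => h0 (Prod.ext h1 h2)
  have hm : ∀ p q : R41, p.2 = 0 → mink p q = 0 → inner ℝ p.1 q.1 = 0 ∧ inner ℝ q.1 p.1 = 0 := by
    intro p q hp h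
    rw [mink_apply, hp, zero_mul, sub_zero] at h
    exact ⟨h, by rw [real_inner_comm]; exact h⟩
  -- On vectors with last coordinate zero the form is the Euclidean inner product, so a nonzero `v`
  -- would give five independent vectors in `ℝ⁴`.
  have hli : LinearIndependent ℝ ![a.1, b.1, c.1, d.1, v.1] := by
    apply linearIndependent_of_ne_zero_of_inner_eq_zero (𝕜 := ℝ)
    · intro i
      fin_cases i
      exacts [key a ha ha0, key b hb hb0, key c hc hc0, key d hd hd0, key v hv hv0]
    · intro i j hij
      fin_cases i <;> fin_cases j <;> first
        | exact absurd rfl hij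
        | exact (hm a b ha hab).1 | exact (hm a b ha hab).2
        | exact (hm a c ha hac).1 | exact (hm a c ha hac).2
        | exact (hm a d ha had).1 | exact (hm a d ha had).2
        | exact (hm b c hb hbc).1 | exact (hm b c hb hbc).2
        | exact (hm b d hb hbd).1 | exact (hm b d hb hbd).2
        | exact (hm c d hc hcd).1 | exact (hm c d hc hcd).2
        | exact (hm v a hv hva).1 | exact (hm v a hv hva).2
        | exact (hm v b hv hvb).1 | exact (hm v b hv hvb).2
        | exact (hm v c hv hvc).1 | exact (hm v c hv hvc).2
        | exact (hm v d hv hvd).1 | exact (hm v d hv hvd).2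
  have := hli.fintype_card_le_finrank
  simp at this

theorem exists_notMem_span_three (a b c : R41) :
    ∃ e : R41, e.2 = 0 ∧ e ∉ Submodule.span ℝ {a, b, c} := by
  have hlt : Submodule.span ℝ ({a.1, b.1, c.1} : Set (EuclideanSpace ℝ (Fin 4))) < ⊤ := by
    apply Submodule.lt_top_of_finrank_lt_finrank
    have h1 := finrank_span_finset_le_card (R := ℝ)
      (({a.1, b.1, c.1} : Finset (EuclideanSpace ℝ (Fin 4))))
    have h2 : ({a.1, b.1, c.1} : Finset (EuclideanSpace ℝ (Fin 4))).card ≤ 3 :=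
      Finset.card_le_three
    simp only [Finset.coe_insert, Finset.coe_singleton] at h1
    rw [finrank_euclideanSpace_fin]
    exact (h1.trans h2).trans_lt (by norm_num)
  obtain ⟨e, -, he⟩ := SetLike.exists_of_lt hlt
  refine ⟨(e, 0), rfl, fun h => he ?_⟩
  have := Submodule.mem_map_of_mem (f := LinearMap.fst ℝ (EuclideanSpace ℝ (Fin 4)) ℝ) h
  rw [Submodule.map_span] at this
  simpa [Set.image_insert_eq] using this

/-! ### Oriented bases of a plane -/

section Plane

variable {T : Type*} [AddCommGroup T] [Module ℝ T] {o : Orientation ℝ T (Fin 2)} {X Y : T}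

theorem PositiveBasis.exists_eq (h : PositiveBasis o X Y) (Z : T) :
    ∃ a b : ℝ, Z = a • X + b • Y := by
  obtain ⟨b, rfl, rfl, -⟩ := h
  refine ⟨b.repr Z 0, b.repr Z 1, ?_⟩
  conv_lhs => rw [← b.sum_repr Z]
  rw [Fin.sum_univ_two]

theorem PositiveBasis.ne_zero_left (h : PositiveBasis o X Y) : X ≠ 0 := by
  obtain ⟨b, rfl, rfl, -⟩ := h
  exact b.ne_zero 0

theorem PositiveBasis.ne_zero_right (h : PositiveBasis o X Y) : Y ≠ 0 := by
  obtain ⟨b, rfl, rfl, -⟩ := h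
  exact b.ne_zero 1

theorem PositiveBasis.det_pos (h : PositiveBasis o X Y) {a b c d : ℝ}
    (h' : PositiveBasis o (a • X + b • Y) (c • X + d • Y)) : 0 < a * d - b * c := by
  obtain ⟨e, rfl, rfl, ho⟩ := h
  obtain ⟨e', h0, h1, ho'⟩ := h'
  have := (e.orientation_eq_iff_det_pos e').1 (ho.trans ho'.symm)
  rw [Module.Basis.det_apply, Matrix.det_fin_two] at this
  simp only [Module.Basis.toMatrix_apply, h0, h1, map_add, map_smul, Finsupp.add_apply,
    Finsupp.smul_apply, Module.Basis.repr_self, smul_eq_mul] at this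
  simpa [mul_comm] using this

theorem PositiveBasis.of_det_pos (h : PositiveBasis o X Y) {a b c d : ℝ}
    (hd : 0 < a * d - b * c) : PositiveBasis o (a • X + b • Y) (c • X + d • Y) := by
  obtain ⟨e, rfl, rfl, ho⟩ := h
  let v : Fin 2 → T := ![a • e 0 + b • e 1, c • e 0 + d • e 1]
  have hdet : e.det v = a * d - b * c := by
    rw [Module.Basis.det_apply, Matrix.det_fin_two]
    simp only [v, Module.Basis.toMatrix_apply, map_add, map_smul, Finsupp.add_apply,
      Finsupp.smul_apply, smul_eq_mul, Matrix.cons_val_zero, Matrix.cons_val_one,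
      Module.Basis.repr_self]
    simp [mul_comm]
  have hu := (e.is_basis_iff_det (v := v)).2 (by rw [hdet]; exact (ne_of_gt hd).isUnit)
  refine ⟨Module.Basis.mk hu.1 hu.2.ge, by simp [v], by simp [v], ?_⟩
  rw [← ho, eq_comm, Module.Basis.orientation_eq_iff_det_pos]
  rw [Module.Basis.coe_mk, hdet]
  exact hd

end Plane

/-! ### The lift of an immersion -/

theorem lift_snd {M : Type*} (f : M → ProjLightCone) (x : M) : (lift f x).2 = 1 := (f x).vec_snd

theorem mink_lift_self {M : Type*} (f : M → ProjLightCone) (x : M) : mink (lift f x) (lift f x) = 0 :=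
  (f x).2 _ (f x).vec_mem

section Frames

variable {M : Type*} [TopologicalSpace M] [ChartedSpace (EuclideanSpace ℝ (Fin 2)) M]
  {f : M → ProjLightCone}

theorem IsImmersion.smoothOn (hf : IsImmersion f) (U : Set M) : SmoothOn (lift f) U :=
  hf.1.mono (Set.subset_univ _)

theorem IsImmersion.diffAt (hf : IsImmersion f) (x : M) : DiffAt (lift f) x :=
  hf.1.diffAt isOpen_univ (Set.mem_univ x)

/-- The last coordinate as a continuous linear map. -/
abbrev sndL : R41 →L[ℝ] ℝ := ContinuousLinearMap.snd ℝ (EuclideanSpace ℝ (Fin 4)) ℝ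

theorem der_snd {g : M → R41} {U : Set M} (hU : IsOpen U) {x : M} (hx : x ∈ U) {c : ℝ}
    (hg : DiffAt g x) (h : ∀ y ∈ U, (g y).2 = c) (v : Tan x) : (der g x v).2 = 0 := by
  have h1 := der_clm sndL hg v
  rw [der_congr hU hx (g := fun y => sndL (g y)) (h := fun _ => c) h, der_const] at h1
  exact h1.symm

theorem der_mink {g h : M → R41} {x : M} (hg : DiffAt g x) (hh : DiffAt h x) (v : Tan x) :
    der (fun y => mink (g y) (h y)) x v = mink (der g x v) (h x) + mink (g x) (der h x v) :=
  der_bilin minkL hg hh v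

theorem SmoothOn.mink {g h : M → R41} {U : Set M} (hg : SmoothOn g U) (hh : SmoothOn h U) :
    SmoothOn (fun y => Isothermic.mink (g y) (h y)) U :=
  SmoothOn.bilin minkL hg hh

theorem IsImmersion.der_snd (hf : IsImmersion f) (x : M) (v : Tan x) :
    (der (lift f) x v).2 = 0 :=
  Isothermic.der_snd isOpen_univ (Set.mem_univ x) (hf.diffAt x) (fun y _ => lift_snd f y) v

theorem IsImmersion.mink_lift_der (hf : IsImmersion f) (x : M) (v : Tan x) :
    mink (lift f x) (der (lift f) x v) = 0 := by
  have h1 := der_mink (hf.diffAt x) (hf.diffAt x) v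
  rw [der_congr isOpen_univ (Set.mem_univ x) (h := fun _ => (0 : ℝ))
    (fun y _ => mink_lift_self f y), der_const, mink_comm (der _ _ _)] at h1
  linarith

theorem firstForm_apply (f : M → ProjLightCone) (x : M) (v w : Tan x) :
    firstForm f x v w = mink (der (lift f) x v) (der (lift f) x w) := rfl

theorem firstForm_comm (f : M → ProjLightCone) (x : M) (v w : Tan x) :
    firstForm f x v w = firstForm f x w v := mink_comm _ _

theorem IsImmersion.der_ne_zero (hf : IsImmersion f) {x : M} {v : Tan x} (hv : v ≠ 0) :
    der (lift f) x v ≠ 0 := fun h => hv (hf.2 x (h.trans (map_zero _).symm))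

theorem IsImmersion.firstForm_pos (hf : IsImmersion f) {x : M} {v : Tan x} (hv : v ≠ 0) :
    0 < firstForm f x v v :=
  mink_self_pos (hf.der_snd x v) (hf.der_ne_zero hv)

theorem IsImmersion.nondegenerate (hf : IsImmersion f) (x : M) :
    (firstForm f x).Nondegenerate := by
  refine ⟨fun v hv => ?_, fun v hv => ?_⟩ <;>
  · by_contra h
    exact (hf.firstForm_pos h).ne' (hv v)

theorem IsImmersion.eq_of_firstForm (hf : IsImmersion f) {x : M} {v w : Tan x}
    (h : ∀ z, firstForm f x v z = firstForm f x w z) : v = w := by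
  by_contra hne
  refine (hf.firstForm_pos (sub_ne_zero.2 hne)).ne' ?_
  have h1 : ∀ z, firstForm f x (v - w) z = 0 := fun z => by
    rw [map_sub, LinearMap.sub_apply, h, sub_self]
  exact h1 _

/-! ### Exterior derivatives of vector-valued one-forms -/

variable {W : Type*} [NormedAddCommGroup W] [NormedSpace ℝ W]

/-- The part `X (η Y) - Y (η X)` of the exterior derivative of a one-form. -/
def curl (η : ∀ x : M, Tan x →ₗ[ℝ] W) (X Y : ∀ x : M, Tan x) (x : M) : W :=
  der (fun y => η y (Y y)) x (X x) - der (fun y => η y (X y)) x (Y x)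

/-- The exterior derivative of a one-form, evaluated on two vector fields. -/
def extDer (η : ∀ x : M, Tan x →ₗ[ℝ] W) (X Y : ∀ x : M, Tan x) (x : M) : W :=
  curl η X Y x - η x (VectorField.mlieBracket (𝓡 2) X Y x)

theorem SmoothOn.combination {η : ∀ x : M, Tan x →ₗ[ℝ] W} {X Y Z : ∀ x : M, Tan x} {U : Set M}
    {a b : M → ℝ} (hX : SmoothOn (fun x => η x (X x)) U) (hY : SmoothOn (fun x => η x (Y x)) U)
    (ha : SmoothOn a U) (hb : SmoothOn b U) (hZ : ∀ y ∈ U, Z y = a y • X y + b y • Y y) :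
    SmoothOn (fun x => η x (Z x)) U :=
  ((ha.smul hX).add (hb.smul hY)).congr fun y hy => by rw [hZ y hy, map_add, map_smul, map_smul]

/-- The Leibniz terms involve `η` only through `η(X)` and `η(Y)`, with coefficients that are the
same for every `η`. Comparing with a closed injective form therefore identifies them with the terms
that come from the bracket. -/
theorem curl_combination {η : ∀ x : M, Tan x →ₗ[ℝ] W} {X Y X' Y' : ∀ x : M, Tan x} {U : Set M}
    {a b c d : M → ℝ} (hU : IsOpen U)
    (hX : SmoothOn (fun x => η x (X x)) U) (hY : SmoothOn (fun x => η x (Y x)) U)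
    (ha : SmoothOn a U) (hb : SmoothOn b U) (hc : SmoothOn c U) (hd : SmoothOn d U)
    (hX' : ∀ y ∈ U, X' y = a y • X y + b y • Y y) (hY' : ∀ y ∈ U, Y' y = c y • X y + d y • Y y)
    {x : M} (hx : x ∈ U) :
    curl η X' Y' x = (a x * d x - b x * c x) • curl η X Y x
      + (der c x (X' x) - der a x (Y' x)) • η x (X x)
      + (der d x (X' x) - der b x (Y' x)) • η x (Y x) := by
  have key : ∀ (p q : M → ℝ) (Z : ∀ x : M, Tan x), SmoothOn p U → SmoothOn q U →
      (∀ y ∈ U, Z y = p y • X y + q y • Y y) → ∀ v : Tan x, der (fun y => η y (Z y)) x v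
        = der p x v • η x (X x) + p x • der (fun y => η y (X y)) x v
          + (der q x v • η x (Y x) + q x • der (fun y => η y (Y y)) x v) := by
    intro p q Z hp hq hZ v
    rw [der_congr hU hx (h := fun y => p y • η y (X y) + q y • η y (Y y))
      (fun y hy => by rw [hZ y hy, map_add, map_smul, map_smul]),
      der_add ((hp.diffAt hU hx).smul (hX.diffAt hU hx))
        ((hq.diffAt hU hx).smul (hY.diffAt hU hx)),
      der_smul (hp.diffAt hU hx) (hX.diffAt hU hx), der_smul (hq.diffAt hU hx) (hY.diffAt hU hx)]
  have eX : ∀ g : Tan x →ₗ[ℝ] W, g (X' x) = a x • g (X x) + b x • g (Y x) := fun g => by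
    rw [hX' x hx, map_add, map_smul, map_smul]
  have eY : ∀ g : Tan x →ₗ[ℝ] W, g (Y' x) = c x • g (X x) + d x • g (Y x) := fun g => by
    rw [hY' x hx, map_add, map_smul, map_smul]
  rw [curl, curl, key c d Y' hc hd hY', key a b X' ha hb hX', eX (der (fun y => η y (X y)) x),
    eX (der (fun y => η y (Y y)) x), eY (der (fun y => η y (X y)) x),
    eY (der (fun y => η y (Y y)) x)]
  module

/-! ### Conformal frames -/

variable [IsManifold (𝓡 2) ∞ M] {o : SurfaceOrientation M}

theorem IsConformalPair.pos {x : M} {X Y : Tan x} (h : IsConformalPair o f x X Y)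
    (hf : IsImmersion f) : 0 < firstForm f x X X :=
  hf.firstForm_pos h.1.ne_zero_left

theorem IsConformalPair.expand {x : M} {X Y : Tan x} (h : IsConformalPair o f x X Y)
    (hf : IsImmersion f) (Z : Tan x) :
    Z = (firstForm f x Z X / firstForm f x X X) • X
      + (firstForm f x Z Y / firstForm f x X X) • Y := by
  obtain ⟨a, b, rfl⟩ := h.1.exists_eq Z
  have hp := (h.pos hf).ne'
  have h1 := firstForm_comm f x Y X
  simp only [map_add, map_smul, LinearMap.add_apply, LinearMap.smul_apply, smul_eq_mul, h1,
    h.2.2, ← h.2.1, mul_zero, add_zero, zero_add, mul_div_assoc, div_self hp, mul_one]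

/-- A conformal pair is determined by its first vector, up to rotation. -/
theorem IsConformalPair.rotation {x : M} {X Y X' Y' : Tan x} (h : IsConformalPair o f x X Y)
    (h' : IsConformalPair o f x X' Y') (hf : IsImmersion f) :
    ∃ a b : ℝ, X' = a • X + b • Y ∧ Y' = (-b) • X + a • Y := by
  obtain ⟨a, b, hX⟩ := h.1.exists_eq X'
  obtain ⟨c, d, hY⟩ := h.1.exists_eq Y'
  subst hX hY
  have hd := h.1.det_pos h'.1
  have hp := h.pos hf
  have h1 := firstForm_comm f x Y X
  have e1 := h'.2.1
  have e2 := h'.2.2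
  simp only [map_add, map_smul, LinearMap.add_apply, LinearMap.smul_apply, smul_eq_mul, h1,
    h.2.2, ← h.2.1, mul_zero, add_zero, zero_add] at e1 e2
  have f1 : a * a + b * b = c * c + d * d := by
    apply mul_right_cancel₀ hp.ne'
    linear_combination e1
  have f2 : a * c + b * d = 0 := by
    apply mul_right_cancel₀ hp.ne'
    linear_combination e2
  -- Lagrange's identity `(ad - bc)² = (a² + b²)(c² + d²) - (ac + bd)²`; the positive determinant
  -- selects the rotation rather than the reflection.
  have f3 : (a * d - b * c) = a * a + b * b := by
    have h2 : (a * d - b * c) ^ 2 = (a * a + b * b) ^ 2 := by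
      linear_combination (-(a * c + b * d)) * f2 - (a * a + b * b) * f1
    exact (pow_left_inj₀ hd.le (by nlinarith [mul_self_nonneg a, mul_self_nonneg b])
      two_ne_zero).1 h2
  have f4 : (c + b) ^ 2 + (d - a) ^ 2 = 0 := by linear_combination -2 * f3 - f1
  have hc : c = -b := by nlinarith [sq_nonneg (c + b), sq_nonneg (d - a)]
  have hda : d = a := by nlinarith [sq_nonneg (c + b), sq_nonneg (d - a)]
  exact ⟨a, b, rfl, by rw [hc, hda]⟩

variable (o f) in
/-- A smooth conformal frame on an open set. -/
structure IsConformalFrame (X Y : ∀ x : M, Tan x) (U : Set M) : Prop where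
  isOpen : IsOpen U
  smooth_left : SmoothField X U
  smooth_right : SmoothField Y U
  pair : ∀ x ∈ U, IsConformalPair o f x (X x) (Y x)

theorem IsConformalFrame.mono {X Y : ∀ x : M, Tan x} {U V : Set M}
    (h : IsConformalFrame f o X Y U) (hV : IsOpen V) (hVU : V ⊆ U) :
    IsConformalFrame f o X Y V :=
  ⟨hV, h.smooth_left.mono hVU, h.smooth_right.mono hVU, fun x hx => h.pair x (hVU hx)⟩

theorem IsImmersion.smoothOn_firstForm (hf : IsImmersion f) {X Y : ∀ x : M, Tan x} {U : Set M}
    (hU : IsOpen U) (hX : SmoothField X U) (hY : SmoothField Y U) :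
    SmoothOn (fun x => firstForm f x (X x) (Y x)) U :=
  (SmoothOn.der hU (hf.smoothOn U) hX).mink (SmoothOn.der hU (hf.smoothOn U) hY)

/-- Gram-Schmidt on a positive frame, except that the second vector is rescaled to the length of the
first instead of normalising both. Both changes of frame have positive determinant, so the
orientation is kept. -/
theorem IsImmersion.exists_conformalFrame (hf : IsImmersion f) (o : SurfaceOrientation M)
    (x : M) : ∃ (U : Set M) (X Y : ∀ y : M, Tan y), x ∈ U ∧ IsConformalFrame f o X Y U := by
  obtain ⟨U, hU, hx, X, Y, hX, hY, hb⟩ := o.exists_frame x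
  let c : M → ℝ := fun y => firstForm f y (X y) (Y y) / firstForm f y (X y) (X y)
  have hXX : ∀ y ∈ U, 0 < firstForm f y (X y) (X y) := fun y hy =>
    hf.firstForm_pos (hb y hy).ne_zero_left
  have hc : SmoothOn c U := (hf.smoothOn_firstForm hU hX hY).div (hf.smoothOn_firstForm hU hX hX)
    fun y hy => (hXX y hy).ne'
  let Z : ∀ y : M, Tan y := fun y => Y y + (-c y) • X y
  have hnc : SmoothOn (fun y => -c y) U :=
    ((smoothOn_const (-1 : ℝ) U).mul hc).congr fun y _ => by ring
  have hZ : SmoothField Z U := hY.add (SmoothField.smul hnc hX)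
  have hbZ : ∀ y ∈ U, PositiveBasis (o.at_pt y) (X y) (Z y) := by
    intro y hy
    have := (hb y hy).of_det_pos (a := 1) (b := 0) (c := -c y) (d := 1) (by norm_num)
    simpa [Z, add_comm] using this
  have hZZ : ∀ y ∈ U, 0 < firstForm f y (Z y) (Z y) := fun y hy =>
    hf.firstForm_pos (hbZ y hy).ne_zero_right
  have hXZ : ∀ y ∈ U, firstForm f y (X y) (Z y) = 0 := by
    intro y hy
    simp only [Z, c, map_add, map_smul, smul_eq_mul]
    field_simp [(hXX y hy).ne']
    ring
  let s : M → ℝ := fun y => √(firstForm f y (X y) (X y) / firstForm f y (Z y) (Z y))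
  have hs0 : ∀ y ∈ U, 0 < firstForm f y (X y) (X y) / firstForm f y (Z y) (Z y) := fun y hy =>
    div_pos (hXX y hy) (hZZ y hy)
  have hs : SmoothOn s U := ((hf.smoothOn_firstForm hU hX hX).div (hf.smoothOn_firstForm hU hZ hZ)
    fun y hy => (hZZ y hy).ne').sqrt hs0
  refine ⟨U, X, fun y => s y • Z y, hx, hU, hX, SmoothField.smul hs hZ, ?_⟩
  intro y hy
  refine ⟨?_, ?_, ?_⟩
  · have := (hbZ y hy).of_det_pos (a := 1) (b := 0) (c := 0) (d := s y)
      (by have hs1 : 0 < s y := Real.sqrt_pos.2 (hs0 y hy)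
          simpa using hs1)
    simpa using this
  · simp only [map_smul, LinearMap.smul_apply, smul_eq_mul]
    rw [← mul_assoc, Real.mul_self_sqrt (hs0 y hy).le, div_mul_cancel₀ _ (hZZ y hy).ne']
  · rw [map_smul, hXZ y hy, smul_zero]

/-- Every smooth vector field is a smooth combination of a conformal frame. -/
theorem IsConformalFrame.exists_coeff {X Y Z : ∀ x : M, Tan x} {U : Set M}
    (h : IsConformalFrame f o X Y U) (hf : IsImmersion f) (hZ : SmoothField Z U) :
    ∃ a b : M → ℝ, SmoothOn a U ∧ SmoothOn b U ∧ ∀ y ∈ U, Z y = a y • X y + b y • Y y := by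
  have hXX : ∀ y ∈ U, firstForm f y (X y) (X y) ≠ 0 := fun y hy => ((h.pair y hy).pos hf).ne'
  exact ⟨_, _, (hf.smoothOn_firstForm h.isOpen hZ h.smooth_left).div
      (hf.smoothOn_firstForm h.isOpen h.smooth_left h.smooth_left) hXX,
    (hf.smoothOn_firstForm h.isOpen hZ h.smooth_right).div
      (hf.smoothOn_firstForm h.isOpen h.smooth_left h.smooth_left) hXX,
    fun y hy => (h.pair y hy).expand hf (Z y)⟩

/-! ### Tensoriality of the exterior derivative -/

/-- The exterior derivative is determined by its value on a conformal frame. -/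
theorem IsConformalFrame.extDer_combination {η : ∀ x : M, Tan x →ₗ[ℝ] W}
    {X Y X' Y' : ∀ x : M, Tan x} {U : Set M} {a b c d : M → ℝ}
    (h : IsConformalFrame f o X Y U) (hf : IsImmersion f)
    (hX : SmoothOn (fun x => η x (X x)) U) (hY : SmoothOn (fun x => η x (Y x)) U)
    (hsX' : SmoothField X' U) (hsY' : SmoothField Y' U)
    (ha : SmoothOn a U) (hb : SmoothOn b U) (hc : SmoothOn c U) (hd : SmoothOn d U)
    (hX' : ∀ y ∈ U, X' y = a y • X y + b y • Y y) (hY' : ∀ y ∈ U, Y' y = c y • X y + d y • Y y)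
    {x : M} (hx : x ∈ U) :
    extDer η X' Y' x = (a x * d x - b x * c x) • extDer η X Y x := by
  -- The bracket is computed through the injective map `dF`: by `der_der_sub`, the curl of `dF` on
  -- two fields is `dF` of their bracket.
  have hbr : VectorField.mlieBracket (𝓡 2) X' Y' x
      = (a x * d x - b x * c x) • VectorField.mlieBracket (𝓡 2) X Y x
        + (der c x (X' x) - der a x (Y' x)) • X x + (der d x (X' x) - der b x (Y' x)) • Y x := by
    apply hf.2 x
    have h1 := curl_combination (η := der (lift f)) h.isOpen
      (SmoothOn.der h.isOpen (hf.smoothOn U) h.smooth_left)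
      (SmoothOn.der h.isOpen (hf.smoothOn U) h.smooth_right) ha hb hc hd hX' hY' hx
    rw [curl, curl, der_der_sub h.isOpen (hf.smoothOn U) hsX' hsY' hx,
      der_der_sub h.isOpen (hf.smoothOn U) h.smooth_left h.smooth_right hx] at h1
    rw [h1, map_add, map_add, map_smul, map_smul, map_smul]
  rw [extDer, extDer, curl_combination h.isOpen hX hY ha hb hc hd hX' hY' hx, hbr, map_add,
    map_add, map_smul, map_smul, map_smul]
  module

/-! ### Unit normals -/

/-- Gram-Schmidt applied to a constant vector `e` of `ℝ⁴` outside the span of `F - t₀`, `dF(X)`,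
`dF(Y)` at `x`. The projected vector `n` is nonzero at `x` but possibly not on all of `U`, hence the
smaller set `V`. -/
theorem IsConformalFrame.exists_unitNormal {X Y : ∀ x : M, Tan x} {U : Set M}
    (h : IsConformalFrame f o X Y U) (hf : IsImmersion f) {x : M} (hx : x ∈ U) :
    ∃ (V : Set M) (N : M → R41), IsOpen V ∧ x ∈ V ∧ V ⊆ U ∧ IsUnitNormal f N V := by
  let u : M → R41 := fun y => der (lift f) y (X y)
  let w : M → R41 := fun y => der (lift f) y (Y y)
  let φ : M → R41 := fun y => lift f y - t0
  have hu : SmoothOn u U := SmoothOn.der h.isOpen (hf.smoothOn U) h.smooth_left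
  have hw : SmoothOn w U := SmoothOn.der h.isOpen (hf.smoothOn U) h.smooth_right
  have hφ : SmoothOn φ U := (hf.smoothOn U).sub (smoothOn_const t0 U)
  obtain ⟨e, he2, he⟩ := exists_notMem_span_three (φ x) (u x) (w x)
  let α : M → ℝ := fun y => mink e (φ y)
  let β : M → ℝ := fun y => mink e (u y) / mink (u y) (u y)
  let γ : M → ℝ := fun y => mink e (w y) / mink (u y) (u y)
  have huu : ∀ y ∈ U, 0 < mink (u y) (u y) := fun y hy => (h.pair y hy).pos hf
  have hww : ∀ y ∈ U, mink (w y) (w y) = mink (u y) (u y) := fun y hy => (h.pair y hy).2.1.symm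
  have huw : ∀ y ∈ U, mink (u y) (w y) = 0 := fun y hy => (h.pair y hy).2.2
  have hsα : SmoothOn α U := (smoothOn_const e U).mink hφ
  have hsβ : SmoothOn β U := ((smoothOn_const e U).mink hu).div (hu.mink hu)
    fun y hy => (huu y hy).ne'
  have hsγ : SmoothOn γ U := ((smoothOn_const e U).mink hw).div (hu.mink hu)
    fun y hy => (huu y hy).ne'
  let n : M → R41 := fun y => e - (α y • φ y + (β y • u y + γ y • w y))
  have hn : SmoothOn n U :=
    (smoothOn_const e U).sub ((hsα.smul hφ).add ((hsβ.smul hu).add (hsγ.smul hw)))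
  have hn0 : n x ≠ 0 := by
    intro h0
    apply he
    rw [sub_eq_zero] at h0
    rw [h0]
    exact Submodule.add_mem _ (Submodule.smul_mem _ _ (Submodule.subset_span (by simp)))
      (Submodule.add_mem _ (Submodule.smul_mem _ _ (Submodule.subset_span (by simp)))
        (Submodule.smul_mem _ _ (Submodule.subset_span (by simp))))
  have hφ2 : ∀ y, (φ y).2 = 0 := fun y => by simp [φ, lift_snd, t0]
  have ht0 : mink t0 t0 = -1 := by simp [mink_apply, t0]
  have hφφ : ∀ y, mink (φ y) (φ y) = 1 := fun y => by
    simp only [φ, map_sub, LinearMap.sub_apply, mink_lift_self, mink_t0, lift_snd, ht0,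
      mink_comm t0 (lift f y)]
    norm_num
  have hφv : ∀ y (v : Tan y), mink (φ y) (der (lift f) y v) = 0 := fun y v => by
    simp only [φ, map_sub, LinearMap.sub_apply, hf.mink_lift_der, mink_comm t0, mink_t0,
      hf.der_snd]
    norm_num
  have hn2 : ∀ y, (n y).2 = 0 := fun y => by
    simp [n, he2, hφ2, u, w, hf.der_snd]
  have hnF : ∀ y, mink (n y) (lift f y) = mink (n y) (φ y) := fun y => by
    simp only [φ, map_sub, mink_t0, hn2]
    norm_num
  have hnφ : ∀ y, mink (n y) (φ y) = 0 := fun y => by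
    have h1 : mink (u y) (φ y) = 0 := (mink_comm _ _).trans (hφv y (X y))
    have h2 : mink (w y) (φ y) = 0 := (mink_comm _ _).trans (hφv y (Y y))
    simp only [n, map_sub, map_add, map_smul, LinearMap.sub_apply, LinearMap.add_apply,
      LinearMap.smul_apply, smul_eq_mul, hφφ, h1, h2, α]
    ring
  have hnu : ∀ y ∈ U, mink (n y) (u y) = 0 := fun y hy => by
    have h1 : mink (φ y) (u y) = 0 := hφv y (X y)
    have h2 : mink (w y) (u y) = 0 := (mink_comm _ _).trans (huw y hy)
    simp only [n, map_sub, map_add, map_smul, LinearMap.sub_apply, LinearMap.add_apply,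
      LinearMap.smul_apply, smul_eq_mul, h1, h2, β, div_mul_cancel₀ _ (huu y hy).ne']
    ring
  have hnw : ∀ y ∈ U, mink (n y) (w y) = 0 := fun y hy => by
    have h1 : mink (φ y) (w y) = 0 := hφv y (Y y)
    simp only [n, map_sub, map_add, map_smul, LinearMap.sub_apply, LinearMap.add_apply,
      LinearMap.smul_apply, smul_eq_mul, h1, huw y hy, hww y hy, γ,
      div_mul_cancel₀ _ (huu y hy).ne']
    ring
  let V : Set M := U ∩ n ⁻¹' {0}ᶜ
  have hV : IsOpen V :=
    (ContMDiffOn.continuousOn hn).isOpen_inter_preimage h.isOpen isOpen_compl_singleton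
  have hnn : ∀ y ∈ V, 0 < mink (n y) (n y) := fun y hy => mink_self_pos (hn2 y) hy.2
  have hnV : SmoothOn n V := hn.mono Set.inter_subset_left
  refine ⟨V, fun y => (√(mink (n y) (n y)))⁻¹ • n y, hV, ⟨hx, hn0⟩, Set.inter_subset_left,
    ?_, ?_, ?_, ?_⟩
  · exact (((hnV.mink hnV).sqrt hnn).inv fun y hy => (Real.sqrt_pos.2 (hnn y hy)).ne').smul hnV
  · intro y hy
    refine ⟨by simp [hn2], ?_⟩
    rw [map_smul, LinearMap.smul_apply, hnF, hnφ, smul_zero]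
  · intro y hy v
    rw [(h.pair y hy.1).expand hf v]
    have h1 := hnu y hy.1
    have h2 := hnw y hy.1
    simp only [u, w] at h1 h2
    simp only [map_add, map_smul, LinearMap.smul_apply, h1, h2, smul_zero, add_zero]
  · intro y hy
    have h1 := Real.mul_self_sqrt (hnn y hy).le
    have h2 := (Real.sqrt_pos.2 (hnn y hy)).ne'
    simp only [map_smul, LinearMap.smul_apply, smul_eq_mul]
    rw [← mul_assoc, ← mul_inv, h1, inv_mul_cancel₀ (hnn y hy).ne']

end Frames

/-! ### Normal form of the elements of `ℓ ∧ ℓ^⊥` -/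

theorem ProjLightCone.eq_smul_vec (p : ProjLightCone) {u : R41} (hu : u ∈ p.line) :
    u = u.2 • p.vec := by
  have h1 := p.vec_snd
  have h2 := hu
  rw [ProjLightCone.line, Projectivization.submodule_eq, Submodule.mem_span_singleton] at h2
  obtain ⟨c, rfl⟩ := h2
  have h3 : p.1.rep.2 ≠ 0 := by
    intro h
    simp [ProjLightCone.vec, h] at h1
  rw [ProjLightCone.vec, smul_smul, Prod.smul_snd, smul_eq_mul, mul_assoc, mul_inv_cancel₀ h3,
    mul_one]

/-- Let `F` be the vector of the line with last coordinate one. As `F ∧ F = 0`, the second factor of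
`F ∧ v` may be shifted by a multiple of `F` until its last coordinate is zero. Then `(F, t₀) = -1`
and `(v, t₀) = 0` give `(F ∧ v) t₀ = -v`, so `v` is recovered linearly from `A`. -/
theorem eq_wedge_of_mem_nilradical {p : ProjLightCone} {A : so41} (hA : A ∈ nilradical p) :
    (A.1 t0).2 = 0 ∧ mink p.vec (A.1 t0) = 0 ∧ A = wedge p.vec (-A.1 t0) := by
  suffices h : ∃ v : R41, v.2 = 0 ∧ mink p.vec v = 0 ∧ A = wedge p.vec v by
    obtain ⟨v, h2, hv, rfl⟩ := h
    have h1 : (wedge p.vec v).1 t0 = -v := by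
      rw [wedge_apply, mink_t0, mink_t0, p.vec_snd, h2]
      simp
    rw [h1, neg_neg, map_neg, hv]
    simp [h2]
  refine Submodule.span_induction ?_ ⟨0, rfl, by simp, by simp⟩ ?_ ?_ hA
  · rintro _ ⟨u, hu, v, hv, rfl⟩
    refine ⟨u.2 • (v - v.2 • p.vec), by simp [p.vec_snd], ?_, ?_⟩
    · have h1 := hv _ p.vec_mem
      have h2 := p.2 _ p.vec_mem
      simp [h1, h2]
    · have h1 := p.eq_smul_vec hu
      apply Subtype.ext
      apply ContinuousLinearMap.ext
      intro w
      rw [wedge_apply, wedge_apply]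
      conv_lhs => rw [h1]
      simp only [map_smul, map_sub, LinearMap.smul_apply, LinearMap.sub_apply, smul_eq_mul]
      module
  · rintro _ _ _ _ ⟨v, h2, hv, rfl⟩ ⟨w, h2', hw, rfl⟩
    exact ⟨v + w, by simp [h2, h2'], by simp [hv, hw], ((wedge p.vec).map_add v w).symm⟩
  · rintro c _ _ ⟨v, h2, hv, rfl⟩
    exact ⟨c • v, by simp [h2], by simp [hv], ((wedge p.vec).map_smul c v).symm⟩

/-! ### Exterior derivatives of `F ∧ ω`, and quadratic differentials in conformal frames -/

section Associated

variable {M : Type*} [TopologicalSpace M] [ChartedSpace (EuclideanSpace ℝ (Fin 2)) M]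
  {f : M → ProjLightCone}

theorem eq_zero_of_wedge_eq_zero {F v : R41} (hF : F.2 = 1) (hv : v.2 = 0) (h : wedge F v = 0) :
    v = 0 := by
  have h1 : (wedge F v).1 t0 = 0 := by rw [h]; rfl
  rw [wedge_apply, mink_t0, mink_t0, hF, hv] at h1
  simpa using h1

/-- The exterior derivative of `F ∧ ω`. -/
theorem extDer_wedge {g : M → R41} {η : ∀ x : M, Tan x →ₗ[ℝ] R41} {X Y : ∀ x : M, Tan x} {x : M}
    (hg : DiffAt g x) (hX : DiffAt (fun y => η y (X y)) x) (hY : DiffAt (fun y => η y (Y y)) x) :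
    extDer (fun y => wedge (g y) ∘ₗ η y) X Y x
      = wedge (der g x (X x)) (η x (Y x)) - wedge (der g x (Y x)) (η x (X x))
        + wedge (g x) (extDer η X Y x) := by
  have h1 := der_bilin wedgeL hg hX (Y x)
  have h2 := der_bilin wedgeL hg hY (X x)
  simp only [wedgeL_apply] at h1 h2
  simp only [extDer, curl, LinearMap.comp_apply]
  rw [h1, h2, (wedge (g x)).map_sub, (wedge (g x)).map_sub]
  abel

theorem der_snd_form {η : ∀ x : M, Tan x →ₗ[ℝ] R41} (h : ∀ x v, (η x v).2 = 0)
    {X Y : ∀ x : M, Tan x} {x : M} (hX : DiffAt (fun y => η y (X y)) x)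
    (hY : DiffAt (fun y => η y (Y y)) x) : (extDer η X Y x).2 = 0 := by
  simp only [extDer, curl, Prod.snd_sub]
  rw [der_snd isOpen_univ (Set.mem_univ x) hX (fun y _ => h y (X y)),
    der_snd isOpen_univ (Set.mem_univ x) hY (fun y _ => h y (Y y)), h]
  simp

/-- The component of the exterior derivative in the direction of a vector field that is orthogonal
to the values of the form. -/
theorem mink_extDer_of_orthogonal {g : M → R41} {η : ∀ x : M, Tan x →ₗ[ℝ] R41} {U : Set M}
    (hU : IsOpen U) (h : ∀ y ∈ U, ∀ v, mink (g y) (η y v) = 0) {X Y : ∀ x : M, Tan x} {x : M}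
    (hx : x ∈ U) (hg : DiffAt g x) (hX : DiffAt (fun y => η y (X y)) x)
    (hY : DiffAt (fun y => η y (Y y)) x) :
    mink (g x) (extDer η X Y x)
      = mink (der g x (Y x)) (η x (X x)) - mink (der g x (X x)) (η x (Y x)) := by
  have h1 := der_mink hg hX (Y x)
  have h2 := der_mink hg hY (X x)
  rw [der_congr hU hx (h := fun _ => (0 : ℝ)) (fun y hy => h y hy _), der_const] at h1 h2
  simp only [extDer, curl, map_sub, h x hx]
  linarith

variable {q : BilinField M}

theorem quadEnd_spec (hf : IsImmersion f) (x : M) (v w : Tan x) :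
    firstForm f x (quadEnd f q x v) w = 2 * (q x v w).re := by
  rw [quadEnd, raise_spec _ _ (hf.nondegenerate x)]
  simp [realForm]

variable (f q) in
/-- The vector-valued one-form `dF ∘ Q`. -/
def quadForm (x : M) : Tan x →ₗ[ℝ] R41 := der (lift f) x ∘ₗ quadEnd f q x

theorem mink_quadForm (hf : IsImmersion f) (x : M) (v w : Tan x) :
    mink (quadForm f q x v) (der (lift f) x w) = 2 * (q x v w).re :=
  quadEnd_spec hf x v w

theorem associatedForm_eq (f : M → ProjLightCone) (q : BilinField M) :
    associatedForm f q = fun x => wedge (lift f x) ∘ₗ ((-(1 / 6 : ℝ)) • quadForm f q x) := by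
  funext x
  apply LinearMap.ext
  intro v
  simp [associatedForm, killingDual, quadForm]

theorem extDer_clm {W W' : Type*} [NormedAddCommGroup W] [NormedSpace ℝ W]
    [NormedAddCommGroup W'] [NormedSpace ℝ W'] (L : W →L[ℝ] W') {η : ∀ x : M, Tan x →ₗ[ℝ] W}
    {X Y : ∀ x : M, Tan x} {x : M} (hX : DiffAt (fun y => η y (X y)) x)
    (hY : DiffAt (fun y => η y (Y y)) x) :
    extDer (fun y => L.toLinearMap ∘ₗ η y) X Y x = L (extDer η X Y x) := by
  have h1 := der_clm L hX (Y x)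
  have h2 := der_clm L hY (X x)
  simp only [extDer, curl, LinearMap.comp_apply, ContinuousLinearMap.coe_coe, h1, h2, map_sub]

theorem associatedForm_mem (hf : IsImmersion f) (q : BilinField M) :
    (associatedForm f q).TakesValuesInNilradical f := by
  intro x v
  refine Submodule.subset_span ⟨lift f x, (f x).vec_mem, (-(1 / 6 : ℝ)) • quadForm f q x v, ?_, ?_⟩
  · intro u hu
    have h1 : u = u.2 • lift f x := (f x).eq_smul_vec hu
    rw [h1, map_smul, map_smul, LinearMap.smul_apply]
    have := hf.mink_lift_der x (quadEnd f q x v)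
    simp only [quadForm, LinearMap.comp_apply, this, smul_zero]
  · rw [associatedForm_eq]; rfl

variable [IsManifold (𝓡 2) ∞ M] {o : SurfaceOrientation M}

namespace IsQuadraticDifferential

theorem apply_right_left (hq : IsQuadraticDifferential o f q) {x : M} {X Y : Tan x}
    (h : IsConformalPair o f x X Y) : q x Y X = Complex.I * q x X X := hq.type_two_zero x X Y h X

theorem apply_left_right (hq : IsQuadraticDifferential o f q) {x : M} {X Y : Tan x}
    (h : IsConformalPair o f x X Y) : q x X Y = Complex.I * q x X X := by
  rw [hq.symm, hq.apply_right_left h]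

theorem apply_right_right (hq : IsQuadraticDifferential o f q) {x : M} {X Y : Tan x}
    (h : IsConformalPair o f x X Y) : q x Y Y = -q x X X := by
  rw [hq.type_two_zero x X Y h, hq.apply_left_right h, ← mul_assoc, Complex.I_mul_I, neg_one_mul]

theorem quadEnd_left (hq : IsQuadraticDifferential o f q) (hf : IsImmersion f) {x : M}
    {X Y : Tan x} (h : IsConformalPair o f x X Y) :
    quadEnd f q x X = (2 * (q x X X).re / firstForm f x X X) • X
      + (-(2 * (q x X X).im) / firstForm f x X X) • Y := by
  rw [h.expand hf (quadEnd f q x X), quadEnd_spec hf, quadEnd_spec hf, hq.apply_left_right h]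
  simp

theorem quadEnd_right (hq : IsQuadraticDifferential o f q) (hf : IsImmersion f) {x : M}
    {X Y : Tan x} (h : IsConformalPair o f x X Y) :
    quadEnd f q x Y = (-(2 * (q x X X).im) / firstForm f x X X) • X
      + (-(2 * (q x X X).re) / firstForm f x X X) • Y := by
  rw [h.expand hf (quadEnd f q x Y), quadEnd_spec hf, quadEnd_spec hf, hq.apply_right_left h,
    hq.apply_right_right h]
  simp

theorem quadForm_left (hq : IsQuadraticDifferential o f q) (hf : IsImmersion f) {x : M}
    {X Y : Tan x} (h : IsConformalPair o f x X Y) :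
    quadForm f q x X = (2 * (q x X X).re / firstForm f x X X) • der (lift f) x X
      + (-(2 * (q x X X).im) / firstForm f x X X) • der (lift f) x Y := by
  rw [quadForm, LinearMap.comp_apply, hq.quadEnd_left hf h, map_add, map_smul, map_smul]

theorem quadForm_right (hq : IsQuadraticDifferential o f q) (hf : IsImmersion f) {x : M}
    {X Y : Tan x} (h : IsConformalPair o f x X Y) :
    quadForm f q x Y = (-(2 * (q x X X).im) / firstForm f x X X) • der (lift f) x X
      + (-(2 * (q x X X).re) / firstForm f x X X) • der (lift f) x Y := by
  rw [quadForm, LinearMap.comp_apply, hq.quadEnd_right hf h, map_add, map_smul, map_smul]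

end IsQuadraticDifferential

namespace IsConformalFrame

variable {X Y : ∀ x : M, Tan x} {U : Set M}

theorem smoothOn_left (h : IsConformalFrame f o X Y U) (hf : IsImmersion f) :
    SmoothOn (fun y => der (lift f) y (X y)) U :=
  SmoothOn.der h.isOpen (hf.smoothOn U) h.smooth_left

theorem smoothOn_right (h : IsConformalFrame f o X Y U) (hf : IsImmersion f) :
    SmoothOn (fun y => der (lift f) y (Y y)) U :=
  SmoothOn.der h.isOpen (hf.smoothOn U) h.smooth_right

theorem smoothOn_coeff (h : IsConformalFrame f o X Y U) (hq : IsQuadraticDifferential o f q) :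
    SmoothOn (fun y => q y (X y) (X y)) U :=
  hq.smooth U X X h.isOpen h.smooth_left h.smooth_left

/-- `Q` is defined pointwise by raising an index, so smoothness is read off its explicit matrix in
the frame. -/
theorem smoothOn_quadForm (h : IsConformalFrame f o X Y U) (hf : IsImmersion f)
    (hq : IsQuadraticDifferential o f q) :
    SmoothOn (fun y => quadForm f q y (X y)) U ∧ SmoothOn (fun y => quadForm f q y (Y y)) U := by
  have hl := hf.smoothOn_firstForm h.isOpen h.smooth_left h.smooth_left
  have hl0 : ∀ y ∈ U, firstForm f y (X y) (X y) ≠ 0 := fun y hy => ((h.pair y hy).pos hf).ne'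
  have ha := ((smoothOn_const (2 : ℝ) U).mul (SmoothOn.clm Complex.reCLM (h.smoothOn_coeff hq))).div
    hl hl0
  have hb := (((smoothOn_const (-2 : ℝ) U).mul
    (SmoothOn.clm Complex.imCLM (h.smoothOn_coeff hq)))).div hl hl0
  have ha' := ((smoothOn_const (-1 : ℝ) U).mul ha)
  have hX := h.smoothOn_left hf
  have hY := h.smoothOn_right hf
  refine ⟨((ha.smul hX).add (hb.smul hY)).congr fun y hy => ?_,
    ((hb.smul hX).add (ha'.smul hY)).congr fun y hy => ?_⟩
  · rw [hq.quadForm_left hf (h.pair y hy)]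
    simp only [Complex.reCLM_apply, Complex.imCLM_apply]
    congr 3; ring
  · rw [hq.quadForm_right hf (h.pair y hy)]
    simp only [Complex.reCLM_apply, Complex.imCLM_apply]
    congr 3 <;> ring

end IsConformalFrame

/-- A one-form is smooth if its values on conformal frames are smooth. -/
theorem smoothOn_of_frames (hf : IsImmersion f) {W : Type*} [NormedAddCommGroup W]
    [NormedSpace ℝ W] {η : ∀ x : M, Tan x →ₗ[ℝ] W}
    (h : ∀ (U : Set M) (X Y : ∀ x : M, Tan x), IsConformalFrame f o X Y U →
      SmoothOn (fun y => η y (X y)) U ∧ SmoothOn (fun y => η y (Y y)) U)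
    {U : Set M} {Z : ∀ x : M, Tan x} (hU : IsOpen U) (hZ : SmoothField Z U) :
    SmoothOn (fun y => η y (Z y)) U := by
  refine smoothOn_of_forall_exists fun x hx => ?_
  obtain ⟨V, X, Y, hxV, hV⟩ := hf.exists_conformalFrame o x
  have hUV := hV.mono (hV.isOpen.inter hU) Set.inter_subset_left
  obtain ⟨a, b, ha, hb, hab⟩ := hUV.exists_coeff hf (hZ.mono Set.inter_subset_right)
  exact ⟨V ∩ U, hUV.isOpen, ⟨hxV, hx⟩,
    SmoothOn.combination (h _ X Y hUV).1 (h _ X Y hUV).2 ha hb hab⟩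

/-- A one-form is closed if its exterior derivative vanishes on conformal frames. -/
theorem extDer_eq_zero_of_frames (hf : IsImmersion f) {W : Type*} [NormedAddCommGroup W]
    [NormedSpace ℝ W] {η : ∀ x : M, Tan x →ₗ[ℝ] W}
    (h : ∀ (U : Set M) (X Y : ∀ x : M, Tan x), IsConformalFrame f o X Y U →
      SmoothOn (fun y => η y (X y)) U ∧ SmoothOn (fun y => η y (Y y)) U ∧
        ∀ x ∈ U, extDer η X Y x = 0)
    {U : Set M} {X' Y' : ∀ x : M, Tan x} (hU : IsOpen U) (hX' : SmoothField X' U)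
    (hY' : SmoothField Y' U) {x : M} (hx : x ∈ U) : extDer η X' Y' x = 0 := by
  obtain ⟨V, X, Y, hxV, hV⟩ := hf.exists_conformalFrame o x
  have hUV := hV.mono (hV.isOpen.inter hU) Set.inter_subset_left
  obtain ⟨a, b, ha, hb, hab⟩ := hUV.exists_coeff hf (hX'.mono Set.inter_subset_right)
  obtain ⟨c, d, hc, hd, hcd⟩ := hUV.exists_coeff hf (hY'.mono Set.inter_subset_right)
  obtain ⟨h1, h2, h3⟩ := h _ X Y hUV
  rw [hUV.extDer_combination hf h1 h2 (hX'.mono Set.inter_subset_right)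
    (hY'.mono Set.inter_subset_right) ha hb hc hd hab hcd ⟨hxV, hx⟩, h3 x ⟨hxV, hx⟩, smul_zero]

theorem OneForm.extDer_eq_zero {η : OneForm M} (h : η.IsClosed) {U : Set M}
    {X Y : ∀ x : M, Tan x} (hU : IsOpen U) (hX : SmoothField X U) (hY : SmoothField Y U) {x : M}
    (hx : x ∈ U) : extDer η X Y x = 0 := h U X Y hU hX hY x hx

/-! ### The form associated with a quadratic differential -/

theorem IsQuadraticDifferential.isSmooth (hq : IsQuadraticDifferential o f q)
    (hf : IsImmersion f) : (associatedForm f q).IsSmooth := by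
  intro U Z hU hZ
  have h1 := smoothOn_of_frames (o := o) hf (η := quadForm f q)
    (fun V X Y h => h.smoothOn_quadForm hf hq) hU hZ
  have h2 := SmoothOn.bilin wedgeL (hf.smoothOn U) ((smoothOn_const (-(1 / 6 : ℝ)) U).smul h1)
  rw [associatedForm_eq]
  exact h2

end Associated

/-! ### The tangential part of `d(dF ∘ Q)`: the Cauchy-Riemann operator -/

/-- Dictionary: `u, w` are `dF(X), dF(Y)`; `p, r` are `dF(QX), dF(QY)`; `l` is the squared length of
`X`; `a + ib` is `q(X, X)`; a suffix `x` or `y` is a derivative along `X` or `Y`; `P, R` are the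
components of `[X, Y]`. The derivatives of `u` and `w` are controlled only by the conformality of
the frame (`hx`, `hy`, `hlx`, `hly`) and by `d(dF) = 0` (`hbr`), which suffices. -/
theorem codazzi_identities {u w p r ux uy wx wy rx py : R41} {l a b ax ay bx b_y P R : ℝ}
    (hl : l ≠ 0) (huu : mink u u = l) (hww : mink w w = l) (hwu : mink w u = 0)
    (hp : p = (2 * a / l) • u + (-(2 * b) / l) • w)
    (hr : r = (-(2 * b) / l) • u + (-(2 * a) / l) • w)
    (pu : mink py u + mink p uy = 2 * ay) (pw : mink py w + mink p wy = -2 * b_y)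
    (ru : mink rx u + mink r ux = -2 * bx) (rw : mink rx w + mink r wx = -2 * ax)
    (hx : mink ux w + mink wx u = 0) (hy : mink uy w + mink wy u = 0)
    (hlx : mink ux u = mink wx w) (hly : mink uy u = mink wy w)
    (hbr : wx - uy = P • u + R • w) :
    mink (rx - py - (P • p + R • r)) u = -2 * (bx + ay + 2 * (P * a - R * b)) ∧
    mink (rx - py - (P • p + R • r)) w = -2 * (ax - b_y - 2 * (P * b + R * a)) := by
  have huw : mink u w = 0 := (mink_comm _ _).trans hwu
  have bu := congrArg (fun z => mink z u) hbr
  have bw := congrArg (fun z => mink z w) hbr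
  subst hp hr
  simp only [map_add, map_smul, map_sub, LinearMap.add_apply, LinearMap.smul_apply,
    LinearMap.sub_apply, smul_eq_mul, huu, hww, huw, hwu, mul_zero, add_zero, zero_add,
    mink_comm u, mink_comm w] at *
  -- With `k` in place of `1 / l` everything is polynomial, modulo the relation `k l = 1`.
  obtain ⟨k, hk⟩ : ∃ k : ℝ, k * l = 1 := ⟨l⁻¹, inv_mul_cancel₀ hl⟩
  have hdiv : ∀ t : ℝ, t / l = t * k := fun t => by rw [div_eq_iff hl, mul_assoc, hk, mul_one]
  simp only [hdiv] at *
  constructor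
  · linear_combination ru - pu + 2 * k * a * hx - 2 * k * a * bu + 2 * k * b * hlx
      + 2 * k * b * bw + (4 * R * b - 4 * P * a) * hk
  · linear_combination rw - pw + 2 * k * a * hy + 2 * k * b * bu + 2 * k * b * hly
      + 2 * k * a * bw + (4 * P * b + 4 * R * a) * hk

section Codazzi

variable {M : Type*} [TopologicalSpace M] [ChartedSpace (EuclideanSpace ℝ (Fin 2)) M]
  {f : M → ProjLightCone} {q : BilinField M} [IsManifold (𝓡 2) ∞ M] {o : SurfaceOrientation M}

/-- The Cauchy-Riemann operator of a quadratic differential in the frame `X, Y`. -/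
def cauchyRiemann (q : BilinField M) (X Y : ∀ x : M, Tan x) (x : M) : ℂ :=
  der (fun y => q y (X y) (X y)) x (X x) + Complex.I * der (fun y => q y (X y) (X y)) x (Y x)
    + 2 * Complex.I * q x (VectorField.mlieBracket (𝓡 2) X Y x) (X x)

variable {X Y : ∀ x : M, Tan x} {U : Set M}

/-- The tangential part of `d (dF ∘ Q)` is the Cauchy-Riemann operator of `q`. -/
theorem IsConformalFrame.mink_extDer_quadForm (h : IsConformalFrame f o X Y U)
    (hf : IsImmersion f) (hq : IsQuadraticDifferential o f q) {x : M} (hx : x ∈ U) :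
    mink (extDer (quadForm f q) X Y x) (der (lift f) x (X x)) = -2 * (cauchyRiemann q X Y x).im ∧
    mink (extDer (quadForm f q) X Y x) (der (lift f) x (Y x)) = -2 * (cauchyRiemann q X Y x).re := by
  have hU := h.isOpen
  have du := (h.smoothOn_left hf).diffAt hU hx
  have dw := (h.smoothOn_right hf).diffAt hU hx
  have dp := (h.smoothOn_quadForm hf hq).1.diffAt hU hx
  have dr := (h.smoothOn_quadForm hf hq).2.diffAt hU hx
  have dc := (h.smoothOn_coeff hq).diffAt hU hx
  have hc := h.pair x hx
  have hl := (hc.pos hf).ne'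
  -- derivatives of the components of the form
  have pu : ∀ v, mink (der (fun y => quadForm f q y (X y)) x v) (der (lift f) x (X x))
      + mink (quadForm f q x (X x)) (der (fun y => der (lift f) y (X y)) x v)
      = 2 * (der (fun y => q y (X y) (X y)) x v).re := fun v => by
    rw [← der_mink dp du, der_congr hU hx
      (h := fun y => ((2 : ℝ) • Complex.reCLM) (q y (X y) (X y)))
      (fun y hy => by rw [mink_quadForm hf]; rfl), der_clm _ dc]
    rfl
  have pw : ∀ v, mink (der (fun y => quadForm f q y (X y)) x v) (der (lift f) x (Y x))
      + mink (quadForm f q x (X x)) (der (fun y => der (lift f) y (Y y)) x v)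
      = -2 * (der (fun y => q y (X y) (X y)) x v).im := fun v => by
    rw [← der_mink dp dw, der_congr hU hx
      (h := fun y => ((-2 : ℝ) • Complex.imCLM) (q y (X y) (X y)))
      (fun y hy => by rw [mink_quadForm hf, hq.apply_left_right (h.pair y hy)]; simp), der_clm _ dc]
    rfl
  have ru : ∀ v, mink (der (fun y => quadForm f q y (Y y)) x v) (der (lift f) x (X x))
      + mink (quadForm f q x (Y x)) (der (fun y => der (lift f) y (X y)) x v)
      = -2 * (der (fun y => q y (X y) (X y)) x v).im := fun v => by
    rw [← der_mink dr du, der_congr hU hx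
      (h := fun y => ((-2 : ℝ) • Complex.imCLM) (q y (X y) (X y)))
      (fun y hy => by rw [mink_quadForm hf, hq.apply_right_left (h.pair y hy)]; simp), der_clm _ dc]
    rfl
  have rw' : ∀ v, mink (der (fun y => quadForm f q y (Y y)) x v) (der (lift f) x (Y x))
      + mink (quadForm f q x (Y x)) (der (fun y => der (lift f) y (Y y)) x v)
      = -2 * (der (fun y => q y (X y) (X y)) x v).re := fun v => by
    rw [← der_mink dr dw, der_congr hU hx
      (h := fun y => ((-2 : ℝ) • Complex.reCLM) (q y (X y) (X y)))
      (fun y hy => by rw [mink_quadForm hf, hq.apply_right_right (h.pair y hy)]; simp), der_clm _ dc]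
    rfl
  -- derivatives of the metric
  have huw : ∀ v, mink (der (fun y => der (lift f) y (X y)) x v) (der (lift f) x (Y x))
      + mink (der (lift f) x (X x)) (der (fun y => der (lift f) y (Y y)) x v) = 0 := fun v => by
    rw [← der_mink du dw, der_congr hU hx (g := fun y => mink (der (lift f) y (X y)) (der (lift f) y (Y y)))
      (h := fun _ => (0 : ℝ)) (fun y hy => (h.pair y hy).2.2), der_const]
  have huu : ∀ v, mink (der (fun y => der (lift f) y (X y)) x v) (der (lift f) x (X x))
      = mink (der (fun y => der (lift f) y (Y y)) x v) (der (lift f) x (Y x)) := fun v => by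
    have h1 := der_mink du du v
    have h2 := der_mink dw dw v
    rw [der_congr hU hx (g := fun y => mink (der (lift f) y (X y)) (der (lift f) y (X y)))
      (h := fun y => mink (der (lift f) y (Y y)) (der (lift f) y (Y y)))
      (fun y hy => (h.pair y hy).2.1), h2,
      mink_comm (der (lift f) x (X x)), mink_comm (der (lift f) x (Y x))] at h1
    linarith
  obtain ⟨P, R, hPR⟩ := hc.1.exists_eq (VectorField.mlieBracket (𝓡 2) X Y x)
  have hbr := der_der_sub hU (hf.smoothOn U) h.smooth_left h.smooth_right hx
  rw [hPR, map_add, map_smul, map_smul] at hbr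
  have hwu : mink (der (lift f) x (Y x)) (der (lift f) x (X x)) = 0 := (mink_comm _ _).trans hc.2.2
  have hw := fun v => mink_comm (der (lift f) x (X x)) (der (fun y => der (lift f) y (Y y)) x v)
  have hqb : q x (P • X x + R • Y x) (X x) = (P + R * Complex.I) * q x (X x) (X x) := by
    rw [map_add, map_smul, map_smul, LinearMap.add_apply, LinearMap.smul_apply,
      LinearMap.smul_apply, hq.apply_right_left hc, Complex.real_smul, Complex.real_smul]
    ring
  have hform : quadForm f q x (P • X x + R • Y x)
      = P • quadForm f q x (X x) + R • quadForm f q x (Y x) := by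
    rw [map_add, map_smul, map_smul]
  obtain ⟨h1, h2⟩ := codazzi_identities hl rfl hc.2.1.symm hwu (hq.quadForm_left hf hc)
    (hq.quadForm_right hf hc) (pu (Y x)) (pw (Y x)) (ru (X x)) (rw' (X x))
    ((congrArg _ (hw (X x)).symm).trans (huw (X x))) ((congrArg _ (hw (Y x)).symm).trans (huw (Y x)))
    (huu (X x)) (huu (Y x)) hbr
  rw [extDer, hPR, hform, cauchyRiemann, hPR, hqb]
  refine ⟨h1.trans ?_, h2.trans ?_⟩
  · simp
  · simp
    ring

end Codazzi

/-! ### The normal part of `d(dF ∘ Q)` and the closedness criterion -/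

theorem wedge_self (u : R41) : wedge u u = 0 := by
  apply Subtype.ext
  apply ContinuousLinearMap.ext
  intro w
  rw [wedge_apply, sub_self]
  rfl

theorem wedge_swap (u v : R41) : wedge u v = -wedge v u := by
  apply Subtype.ext
  apply ContinuousLinearMap.ext
  intro w
  rw [Submodule.coe_neg, neg_apply, wedge_apply, wedge_apply]
  abel

/-- The endomorphisms that represent two symmetric forms commute if and only if one of them is
symmetric for the other form. -/
theorem raise_comm_iff {T : Type*} [AddCommGroup T] [Module ℝ T] [FiniteDimensional ℝ T]
    {g b s : LinearMap.BilinForm ℝ T} (hg : g.Nondegenerate) (hgs : ∀ v w, g v w = g w v)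
    (hb : ∀ v w, b v w = b w v) (hs : ∀ v w, s v w = s w v) :
    raise g b ∘ₗ raise g s = raise g s ∘ₗ raise g b ↔
      ∀ v w, s v (raise g b w) = s w (raise g b v) := by
  have h1 : ∀ v w, g ((raise g b ∘ₗ raise g s) v) w = s v (raise g b w) := fun v w => by
    rw [LinearMap.comp_apply, raise_spec _ _ hg, hb, ← raise_spec g b hg, hgs, raise_spec _ _ hg]
  have h2 : ∀ v w, g ((raise g s ∘ₗ raise g b) v) w = s w (raise g b v) := fun v w => by
    rw [LinearMap.comp_apply, raise_spec _ _ hg, hs]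
  constructor
  · intro h v w
    rw [← h1, ← h2, h]
  · intro h
    apply LinearMap.ext
    intro v
    rw [← sub_eq_zero]
    apply hg.1
    intro w
    rw [map_sub, LinearMap.sub_apply, h1, h2, h, sub_self]

section Main

variable {M : Type*} [TopologicalSpace M] [ChartedSpace (EuclideanSpace ℝ (Fin 2)) M]
  {f : M → ProjLightCone} {q : BilinField M}

theorem IsUnitNormal.mono {N : M → R41} {U V : Set M} (h : IsUnitNormal f N U) (hV : V ⊆ U) :
    IsUnitNormal f N V :=
  ⟨h.smooth.mono hV, fun x hx => h.tangent_sphere x (hV hx), fun x hx => h.normal x (hV hx),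
    fun x hx => h.unit x (hV hx)⟩

theorem quadForm_snd (hf : IsImmersion f) (x : M) (v : Tan x) : (quadForm f q x v).2 = 0 :=
  hf.der_snd x _

theorem mink_lift_quadForm (hf : IsImmersion f) (x : M) (v : Tan x) :
    mink (lift f x) (quadForm f q x v) = 0 :=
  hf.mink_lift_der x _

variable [IsManifold (𝓡 2) ∞ M] {o : SurfaceOrientation M} {X Y : ∀ x : M, Tan x} {U : Set M}

theorem extDer_der_lift (hf : IsImmersion f) (hU : IsOpen U) (hX : SmoothField X U)
    (hY : SmoothField Y U) {x : M} (hx : x ∈ U) : extDer (der (lift f)) X Y x = 0 := by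
  rw [extDer, curl, der_der_sub hU (hf.smoothOn U) hX hY hx, sub_self]

/-- The antisymmetric part of `II` is the `N`-component of `d(dF) = 0`. -/
theorem IsConformalFrame.secondForm_comm (h : IsConformalFrame f o X Y U) (hf : IsImmersion f)
    {N : M → R41} (hN : IsUnitNormal f N U) {x : M} (hx : x ∈ U) (v w : Tan x) :
    secondForm f N x v w = secondForm f N x w v := by
  have h1 := mink_extDer_of_orthogonal h.isOpen hN.normal hx (hN.smooth.diffAt h.isOpen hx)
    ((h.smoothOn_left hf).diffAt h.isOpen hx) ((h.smoothOn_right hf).diffAt h.isOpen hx)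
  rw [extDer_der_lift hf h.isOpen h.smooth_left h.smooth_right hx, map_zero] at h1
  have h2 : secondForm f N x (Y x) (X x) = secondForm f N x (X x) (Y x) := by
    simp only [secondForm, LinearMap.neg_apply, LinearMap.compl₁₂_apply]
    linarith
  obtain ⟨a, b, rfl⟩ := (h.pair x hx).1.exists_eq v
  obtain ⟨c, d, rfl⟩ := (h.pair x hx).1.exists_eq w
  simp only [map_add, map_smul, LinearMap.add_apply, LinearMap.smul_apply, smul_eq_mul, h2]
  ring

theorem quadEnd_symm (hf : IsImmersion f) (hq : IsQuadraticDifferential o f q) (x : M)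
    (v w : Tan x) : firstForm f x v (quadEnd f q x w) = firstForm f x w (quadEnd f q x v) := by
  rw [firstForm_comm, quadEnd_spec hf, firstForm_comm, quadEnd_spec hf, hq.symm]

/-- The normal part of `d (dF ∘ Q)` is the commutator of `Q` with the second fundamental form. -/
theorem IsConformalFrame.commute_iff (h : IsConformalFrame f o X Y U) (hf : IsImmersion f)
    (hq : IsQuadraticDifferential o f q) {N : M → R41} (hN : IsUnitNormal f N U) {x : M}
    (hx : x ∈ U) :
    quadEnd f q x ∘ₗ raise (firstForm f x) (tracefreeSecondForm f N x)
        = raise (firstForm f x) (tracefreeSecondForm f N x) ∘ₗ quadEnd f q x ↔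
      mink (N x) (extDer (quadForm f q) X Y x) = 0 := by
  have hII := h.secondForm_comm hf hN hx
  have hb : ∀ v w, realForm q x v w = realForm q x w v := fun v w => by
    simp [realForm, hq.symm x v w]
  have hs : ∀ v w, tracefreeSecondForm f N x v w = tracefreeSecondForm f N x w v := fun v w => by
    simp only [tracefreeSecondForm, LinearMap.sub_apply, LinearMap.smul_apply, hII v w,
      firstForm_comm f x v w]
  -- `II₀` and `II` differ by a multiple of the metric, for which `Q` is symmetric, so the trace
  -- part drops out.
  have hd : ∀ v w, tracefreeSecondForm f N x v (quadEnd f q x w)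
      - tracefreeSecondForm f N x w (quadEnd f q x v)
      = secondForm f N x v (quadEnd f q x w) - secondForm f N x w (quadEnd f q x v) :=
    fun v w => by
      simp only [tracefreeSecondForm, LinearMap.sub_apply, LinearMap.smul_apply,
        quadEnd_symm hf hq x v w]
      abel
  have hperp : ∀ y ∈ U, ∀ v, mink (N y) (quadForm f q y v) = 0 := fun y hy v =>
    hN.normal y hy _
  have hQ := h.smoothOn_quadForm hf hq
  have hXY : mink (N x) (extDer (quadForm f q) X Y x)
      = secondForm f N x (X x) (quadEnd f q x (Y x))
        - secondForm f N x (Y x) (quadEnd f q x (X x)) := by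
    rw [mink_extDer_of_orthogonal h.isOpen hperp hx (hN.smooth.diffAt h.isOpen hx)
      (hQ.1.diffAt h.isOpen hx) (hQ.2.diffAt h.isOpen hx)]
    simp only [secondForm, LinearMap.neg_apply, LinearMap.compl₁₂_apply, quadForm,
      LinearMap.comp_apply]
    ring
  have hr := raise_comm_iff (hf.nondegenerate x) (firstForm_comm f x) hb hs
  rw [quadEnd, hr, hXY]
  change (∀ v w, tracefreeSecondForm f N x v (quadEnd f q x w)
    = tracefreeSecondForm f N x w (quadEnd f q x v)) ↔ _
  constructor
  · intro H
    rw [← hd, H, sub_self]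
  · intro H v w
    rw [← sub_eq_zero, hd]
    -- The defect is antisymmetric in `v, w`, so on a plane its value on `X, Y` determines it.
    obtain ⟨a, b, rfl⟩ := (h.pair x hx).1.exists_eq v
    obtain ⟨c, d, rfl⟩ := (h.pair x hx).1.exists_eq w
    simp only [map_add, map_smul, LinearMap.add_apply, LinearMap.smul_apply, smul_eq_mul]
    linear_combination (a * d - b * c) * H

/-- The other term of the product rule, `dF ∧ ω`, vanishes because `Q` is trace-free. -/
theorem IsConformalFrame.extDer_associatedForm (h : IsConformalFrame f o X Y U)
    (hf : IsImmersion f) (hq : IsQuadraticDifferential o f q) {x : M} (hx : x ∈ U) :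
    extDer (associatedForm f q) X Y x
      = wedge (lift f x) (-(1 / 6 : ℝ) • extDer (quadForm f q) X Y x) := by
  have hX := (h.smoothOn_quadForm hf hq).1.diffAt h.isOpen hx
  have hY := (h.smoothOn_quadForm hf hq).2.diffAt h.isOpen hx
  have hc := h.pair x hx
  have h1 := extDer_clm (-(1 / 6 : ℝ) • ContinuousLinearMap.id ℝ R41) hX hY
  have h2 := extDer_wedge (hf.diffAt x) (η := fun y => (-(1 / 6 : ℝ)) • quadForm f q y)
    (hX.clm (-(1 / 6 : ℝ) • ContinuousLinearMap.id ℝ R41))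
    (hY.clm (-(1 / 6 : ℝ) • ContinuousLinearMap.id ℝ R41))
  have h3 : extDer (fun y => (-(1 / 6 : ℝ)) • quadForm f q y) X Y x
      = -(1 / 6 : ℝ) • extDer (quadForm f q) X Y x := h1
  have h4 := wedge_swap (der (lift f) x (Y x)) (der (lift f) x (X x))
  rw [associatedForm_eq, h2, h3, add_eq_right, LinearMap.smul_apply, LinearMap.smul_apply,
    hq.quadForm_left hf hc, hq.quadForm_right hf hc]
  simp only [smul_add, (wedge _).map_add, (wedge _).map_smul, wedge_self, h4]
  module

theorem IsConformalFrame.extDer_quadForm_snd (h : IsConformalFrame f o X Y U)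
    (hf : IsImmersion f) (hq : IsQuadraticDifferential o f q) {x : M} (hx : x ∈ U) :
    (extDer (quadForm f q) X Y x).2 = 0 :=
  der_snd_form (quadForm_snd hf) ((h.smoothOn_quadForm hf hq).1.diffAt h.isOpen hx)
    ((h.smoothOn_quadForm hf hq).2.diffAt h.isOpen hx)

theorem IsConformalFrame.mink_lift_extDer (h : IsConformalFrame f o X Y U)
    (hf : IsImmersion f) (hq : IsQuadraticDifferential o f q) {x : M} (hx : x ∈ U) :
    mink (lift f x) (extDer (quadForm f q) X Y x) = 0 := by
  rw [mink_extDer_of_orthogonal h.isOpen (fun y _ v => mink_lift_quadForm hf y v) hx (hf.diffAt x)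
    ((h.smoothOn_quadForm hf hq).1.diffAt h.isOpen hx)
    ((h.smoothOn_quadForm hf hq).2.diffAt h.isOpen hx), mink_comm, mink_quadForm hf,
    mink_comm, mink_quadForm hf, hq.symm, sub_self]

/-- The value lies in `ℝ⁴`, where `F - t₀`, `dF(X)`, `dF(Y)` and `N` are orthogonal and nonzero. The
two hypotheses cover the last three directions, and the symmetry of `q` covers the first. -/
theorem IsConformalFrame.extDer_quadForm_eq_zero (h : IsConformalFrame f o X Y U)
    (hf : IsImmersion f) (hq : IsQuadraticDifferential o f q) {N : M → R41}
    (hN : IsUnitNormal f N U) {x : M} (hx : x ∈ U) (hcr : cauchyRiemann q X Y x = 0)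
    (hn : mink (N x) (extDer (quadForm f q) X Y x) = 0) : extDer (quadForm f q) X Y x = 0 := by
  obtain ⟨hu, hw⟩ := h.mink_extDer_quadForm hf hq hx
  rw [hcr] at hu hw
  have hc := h.pair x hx
  have hv2 := h.extDer_quadForm_snd hf hq hx
  have hφ : ∀ v : R41, v.2 = 0 → mink v (lift f x - t0) = mink (lift f x) v := fun v hv => by
    rw [map_sub, mink_t0, hv, mink_comm]
    simp
  have hn0 : N x ≠ 0 := fun h0 => by
    have := hN.unit x hx
    rw [h0, map_zero] at this
    exact zero_ne_one this
  have hφ0 : lift f x - t0 ≠ 0 := fun h0 => by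
    have h1 := mink_lift_self f x
    rw [sub_eq_zero.1 h0, mink_t0] at h1
    norm_num [t0] at h1
  refine eq_zero_of_orthogonal (a := lift f x - t0) (b := der (lift f) x (X x))
    (c := der (lift f) x (Y x)) (d := N x) ?_ (hf.der_snd x _) (hf.der_snd x _)
    (hN.tangent_sphere x hx).1 hv2 hφ0 (hf.der_ne_zero hc.1.ne_zero_left)
    (hf.der_ne_zero hc.1.ne_zero_right) hn0 ?_ ?_ ?_ hc.2.2
    ((mink_comm _ _).trans (hN.normal x hx _)) ((mink_comm _ _).trans (hN.normal x hx _)) ?_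
    (by simpa using hu) (by simpa using hw) ((mink_comm _ _).trans hn)
  · simp [lift_snd, t0]
  · rw [mink_comm, hφ _ (hf.der_snd x _), hf.mink_lift_der]
  · rw [mink_comm, hφ _ (hf.der_snd x _), hf.mink_lift_der]
  · rw [mink_comm, hφ _ (hN.tangent_sphere x hx).1, mink_comm, (hN.tangent_sphere x hx).2]
  · rw [hφ _ hv2, h.mink_lift_extDer hf hq hx]

/-- A quadratic differential is holomorphic and commutes with the second fundamental form if and
only if the associated form is closed. -/
theorem IsQuadraticDifferential.isClosed_iff (hq : IsQuadraticDifferential o f q)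
    (hf : IsImmersion f) :
    IsHolomorphic o f q ∧ CommutesWithSecondForm f q ↔ (associatedForm f q).IsClosed := by
  constructor
  · rintro ⟨hh, hcom⟩ U X Y hU hX hY x hx
    refine extDer_eq_zero_of_frames (o := o) hf (fun V X Y h =>
      ⟨hq.isSmooth hf V X h.isOpen h.smooth_left, hq.isSmooth hf V Y h.isOpen h.smooth_right,
        fun x hx => ?_⟩) hU hX hY hx
    obtain ⟨V', N, hV', hxV', hV'V, hN⟩ := h.exists_unitNormal hf hx
    have h' := h.mono hV' hV'V
    rw [h.extDer_associatedForm hf hq hx, h'.extDer_quadForm_eq_zero hf hq hN hxV'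
      (hh V X Y h.isOpen h.smooth_left h.smooth_right h.pair x hx)
      ((h'.commute_iff hf hq hN hxV').1 (hcom V' N hV' hN x hxV')), smul_zero, map_zero]
  · intro hcl
    have key : ∀ (U : Set M) (X Y : ∀ x : M, Tan x), IsConformalFrame f o X Y U → ∀ x ∈ U,
        extDer (quadForm f q) X Y x = 0 := by
      intro U X Y h x hx
      have h1 := OneForm.extDer_eq_zero hcl h.isOpen h.smooth_left h.smooth_right hx
      rw [h.extDer_associatedForm hf hq hx] at h1
      have h2 := eq_zero_of_wedge_eq_zero (lift_snd f x)
        (by simp [h.extDer_quadForm_snd hf hq hx]) h1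
      simpa using h2
    refine ⟨fun U X Y hU hX hY hp x hx => ?_, fun U N hU hN x hx => ?_⟩
    · have h : IsConformalFrame f o X Y U := ⟨hU, hX, hY, hp⟩
      obtain ⟨hu, hw⟩ := h.mink_extDer_quadForm hf hq hx
      rw [key U X Y h x hx, map_zero, LinearMap.zero_apply] at hu hw
      change cauchyRiemann q X Y x = 0
      exact Complex.ext (by simpa using hw) (by simpa using hu)
    · obtain ⟨V, X, Y, hxV, h⟩ := hf.exists_conformalFrame o x
      have h' := h.mono (h.isOpen.inter hU) Set.inter_subset_left
      rw [h'.commute_iff hf hq (hN.mono Set.inter_subset_right) ⟨hxV, hx⟩,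
        key _ X Y h' x ⟨hxV, hx⟩, map_zero]

end Main

/-! ### From closed forms back to quadratic differentials -/

/-- The components of a solution of `u ∧ r = w ∧ p`. -/
theorem eq_of_wedge_eq {u w p r : R41} (hw : mink w w = mink u u) (huw : mink u w = 0)
    (h : wedge u r = wedge w p) :
    mink u u • r = mink r u • u - mink p u • w ∧ mink u u • p = mink p w • w - mink r w • u := by
  have hwu : mink w u = 0 := (mink_comm _ _).trans huw
  have h1 : (wedge u r).1 u = (wedge w p).1 u := by rw [h]
  have h2 : (wedge u r).1 w = (wedge w p).1 w := by rw [h]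
  rw [wedge_apply, wedge_apply, hwu, zero_smul, zero_sub] at h1
  rw [wedge_apply, wedge_apply, huw, hw, zero_smul, zero_sub] at h2
  constructor
  · rw [sub_eq_iff_eq_add.1 h1]
    abel
  · rw [eq_add_of_sub_eq h2.symm]
    abel

section Converse

variable {M : Type*} [TopologicalSpace M] [ChartedSpace (EuclideanSpace ℝ (Fin 2)) M]
  {f : M → ProjLightCone}

/-- The one-form `ω` with values in Minkowski space such that `η = F ∧ ω`. -/
def vectorForm (η : OneForm M) (x : M) : Tan x →ₗ[ℝ] R41 :=
  (-evalL t0).toLinearMap ∘ₗ η x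

theorem vectorForm_spec {η : OneForm M} (hη : η.TakesValuesInNilradical f) (x : M) (v : Tan x) :
    (vectorForm η x v).2 = 0 ∧ mink (lift f x) (vectorForm η x v) = 0 ∧
      η x v = wedge (lift f x) (vectorForm η x v) := by
  obtain ⟨h1, h2, h3⟩ := eq_wedge_of_mem_nilradical (hη x v)
  have h : vectorForm η x v = -(η x v).1 t0 := rfl
  rw [h]
  refine ⟨by simp [h1], by rw [map_neg, lift, h2, neg_zero], h3⟩

/-- The bilinear form `q + q̄` of a one-form with values in `f ∧ f^⊥`. -/
def pairing (f : M → ProjLightCone) (η : OneForm M) (x : M) : LinearMap.BilinForm ℝ (Tan x) :=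
  (-6 : ℝ) • mink.compl₁₂ (vectorForm η x) (der (lift f) x)

theorem pairing_apply (f : M → ProjLightCone) (η : OneForm M) (x : M) (v w : Tan x) :
    pairing f η x v w = -6 * mink (vectorForm η x v) (der (lift f) x w) := rfl

/-- The `(2,0)`-form with given real part and complex structure. -/
def ofReal (B : ∀ x : M, LinearMap.BilinForm ℝ (Tan x)) (J : ∀ x : M, Tan x →ₗ[ℝ] Tan x) :
    BilinField M := fun x =>
  LinearMap.mk₂ ℝ (fun v w => ((B x v w : ℂ) - Complex.I * (B x (J x v) w : ℂ)) / 2)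
    (fun v v' w => by simp only [map_add, LinearMap.add_apply]; push_cast; ring)
    (fun c v w => by
      simp only [map_smul, LinearMap.smul_apply, smul_eq_mul, Complex.real_smul]
      push_cast; ring)
    (fun v w w' => by simp only [map_add]; push_cast; ring)
    (fun c v w => by
      simp only [map_smul, smul_eq_mul, Complex.real_smul]; push_cast; ring)

theorem ofReal_apply (B : ∀ x : M, LinearMap.BilinForm ℝ (Tan x))
    (J : ∀ x : M, Tan x →ₗ[ℝ] Tan x) (x : M) (v w : Tan x) :
    ofReal B J x v w = ((B x v w : ℂ) - Complex.I * (B x (J x v) w : ℂ)) / 2 := rfl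

variable [IsManifold (𝓡 2) ∞ M] {o : SurfaceOrientation M} {η : OneForm M}

theorem vectorForm_smoothOn (hs : η.IsSmooth) {U : Set M} {X : ∀ x : M, Tan x} (hU : IsOpen U)
    (hX : SmoothField X U) : SmoothOn (fun y => vectorForm η y (X y)) U :=
  SmoothOn.clm (-evalL t0) (hs U X hU hX)

theorem IsConformalFrame.pairing_spec {X Y : ∀ x : M, Tan x} {U : Set M}
    (h : IsConformalFrame f o X Y U) (hf : IsImmersion f) (hs : η.IsSmooth) (hc : η.IsClosed)
    (hη : η.TakesValuesInNilradical f) {x : M} (hx : x ∈ U) :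
    pairing f η x (X x) (Y x) = pairing f η x (Y x) (X x) ∧
    pairing f η x (X x) (X x) + pairing f η x (Y x) (Y x) = 0 ∧
    ∀ v, ∃ z, vectorForm η x v = der (lift f) x z := by
  have hU := h.isOpen
  have hp := h.pair x hx
  have hl := (hp.pos hf).ne'
  have hX := (vectorForm_smoothOn hs hU h.smooth_left).diffAt hU hx
  have hY := (vectorForm_smoothOn hs hU h.smooth_right).diffAt hU hx
  have hext : extDer η X Y x = 0 :=
    OneForm.extDer_eq_zero hc hU h.smooth_left h.smooth_right hx
  -- `ω` is obtained from `η` by evaluation at the constant vector `-t₀`, which commutes with `d`.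
  have hv : extDer (vectorForm η) X Y x = 0 := by
    have h1 := extDer_clm (-evalL t0) (η := η) (X := X) (Y := Y)
      ((hs U X hU h.smooth_left).diffAt hU hx) ((hs U Y hU h.smooth_right).diffAt hU hx)
    rw [hext, map_zero] at h1
    exact h1
  -- The `F`-component of `dω = 0` gives the symmetry of the pairing of `ω` with `dF`; the equation
  -- `dF ∧ ω = 0` alone does not.
  have hsym := mink_extDer_of_orthogonal hU (η := vectorForm η)
    (fun y _ v => (vectorForm_spec hη y v).2.1) hx (hf.diffAt x) hX hY
  have hηe : η = fun y => wedge (lift f y) ∘ₗ vectorForm η y := by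
    funext y
    apply LinearMap.ext
    intro v
    exact (vectorForm_spec hη y v).2.2
  have hw := extDer_wedge (hf.diffAt x) hX hY
  rw [← hηe, hext, hv, map_zero, add_zero, eq_comm, sub_eq_zero] at hw
  rw [hv, map_zero, eq_comm, sub_eq_zero] at hsym
  rw [firstForm_apply] at hl
  obtain ⟨h1, h2⟩ := eq_of_wedge_eq hp.2.1.symm hp.2.2 hw
  have hX' : vectorForm η x (X x) = (mink (der (lift f) x (X x)) (der (lift f) x (X x)))⁻¹ •
      (mink (vectorForm η x (X x)) (der (lift f) x (Y x)) • der (lift f) x (Y x)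
        - mink (vectorForm η x (Y x)) (der (lift f) x (Y x)) • der (lift f) x (X x)) := by
    rw [← h2, smul_smul, inv_mul_cancel₀ hl, one_smul]
  have hY' : vectorForm η x (Y x) = (mink (der (lift f) x (X x)) (der (lift f) x (X x)))⁻¹ •
      (mink (vectorForm η x (Y x)) (der (lift f) x (X x)) • der (lift f) x (X x)
        - mink (vectorForm η x (X x)) (der (lift f) x (X x)) • der (lift f) x (Y x)) := by
    rw [← h1, smul_smul, inv_mul_cancel₀ hl, one_smul]
  refine ⟨?_, ?_, fun v => ?_⟩
  · rw [pairing_apply, pairing_apply, mink_comm (vectorForm η x (X x)),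
      mink_comm (vectorForm η x (Y x)), hsym]
  · have hwu : mink (der (lift f) x (Y x)) (der (lift f) x (X x)) = 0 :=
      (mink_comm _ _).trans hp.2.2
    -- The `dF(X)`-component of the solution of `dF ∧ ω = 0` is the trace condition.
    have h3 := congrArg (fun z => mink z (der (lift f) x (X x))) h2
    simp only [map_sub, map_smul, LinearMap.sub_apply, LinearMap.smul_apply, smul_eq_mul, hwu]
      at h3
    rw [pairing_apply, pairing_apply]
    apply mul_left_cancel₀ hl
    linear_combination -6 * h3
  · obtain ⟨a, b, rfl⟩ := hp.1.exists_eq v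
    have hmem : ∀ z ∈ ({X x, Y x} : Set (Tan x)),
        vectorForm η x z ∈ LinearMap.range (der (lift f) x) := by
      have hr := fun z => LinearMap.mem_range_self (der (lift f) x) z
      rintro z (rfl | rfl)
      · rw [hX']
        exact Submodule.smul_mem _ _ (Submodule.sub_mem _ (Submodule.smul_mem _ _ (hr _))
          (Submodule.smul_mem _ _ (hr _)))
      · rw [hY']
        exact Submodule.smul_mem _ _ (Submodule.sub_mem _ (Submodule.smul_mem _ _ (hr _))
          (Submodule.smul_mem _ _ (hr _)))
    have : vectorForm η x (a • X x + b • Y x) ∈ LinearMap.range (der (lift f) x) := by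
      rw [map_add, map_smul, map_smul]
      exact Submodule.add_mem _ (Submodule.smul_mem _ _ (hmem _ (by simp)))
        (Submodule.smul_mem _ _ (hmem _ (by simp)))
    obtain ⟨z, hz⟩ := this
    exact ⟨z, hz.symm⟩

/-- The complex structure of the surface. -/
theorem exists_rotation (hf : IsImmersion f) (o : SurfaceOrientation M) (x : M) :
    ∃ J : Tan x →ₗ[ℝ] Tan x, ∀ X Y, IsConformalPair o f x X Y → J X = Y ∧ J Y = -X := by
  obtain ⟨U, X₀, Y₀, hx, h⟩ := hf.exists_conformalFrame o x
  have hp := h.pair x hx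
  have hl := (hp.pos hf).ne'
  let J : Tan x →ₗ[ℝ] Tan x := (firstForm f x (X₀ x) (X₀ x))⁻¹ •
    (((firstForm f x (X₀ x)).smulRight (Y₀ x)) - ((firstForm f x (Y₀ x)).smulRight (X₀ x)))
  have hX : J (X₀ x) = Y₀ x := by
    simp [J, firstForm_comm f x (Y₀ x), hp.2.2, smul_smul, inv_mul_cancel₀ hl]
  have hY : J (Y₀ x) = -X₀ x := by
    simp [J, hp.2.2, ← hp.2.1, smul_smul, inv_mul_cancel₀ hl]
  refine ⟨J, fun X Y h' => ?_⟩
  obtain ⟨a, b, rfl, rfl⟩ := hp.rotation h' hf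
  simp only [map_add, map_smul, hX, hY]
  constructor <;> module

/-- A closed one-form with values in `f ∧ f^⊥` is associated with a quadratic differential. -/
theorem exists_quadraticDifferential (hf : IsImmersion f) (o : SurfaceOrientation M)
    (hs : η.IsSmooth) (hc : η.IsClosed) (hη : η.TakesValuesInNilradical f) :
    ∃ q : BilinField M, IsQuadraticDifferential o f q ∧ associatedForm f q = η := by
  choose J hJ using exists_rotation hf o
  have hB : ∀ x, ∃ X Y : Tan x, IsConformalPair o f x X Y ∧
      pairing f η x X Y = pairing f η x Y X ∧ pairing f η x X X + pairing f η x Y Y = 0 ∧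
      ∀ v, ∃ z, vectorForm η x v = der (lift f) x z := fun x => by
    obtain ⟨U, X, Y, hx, h⟩ := hf.exists_conformalFrame o x
    exact ⟨X x, Y x, h.pair x hx, h.pairing_spec hf hs hc hη hx⟩
  have hBs : ∀ x v w, pairing f η x v w = pairing f η x w v := by
    intro x v w
    obtain ⟨X, Y, hp, h1, -, -⟩ := hB x
    obtain ⟨a, b, rfl⟩ := hp.1.exists_eq v
    obtain ⟨c, d, rfl⟩ := hp.1.exists_eq w
    simp only [map_add, map_smul, LinearMap.add_apply, LinearMap.smul_apply, smul_eq_mul, h1]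
    ring
  -- This is where trace-freeness is used: it is what makes `B(J·, ·)`, the imaginary part of `q` up
  -- to a factor, symmetric.
  have hBJ : ∀ x v w, pairing f η x (J x v) w = pairing f η x (J x w) v := by
    intro x v w
    obtain ⟨X, Y, hp, h1, h2, -⟩ := hB x
    obtain ⟨a, b, rfl⟩ := hp.1.exists_eq v
    obtain ⟨c, d, rfl⟩ := hp.1.exists_eq w
    obtain ⟨hX, hY⟩ := hJ x X Y hp
    simp only [map_add, map_smul, map_neg, LinearMap.add_apply, LinearMap.smul_apply,
      LinearMap.neg_apply, smul_eq_mul, h1, hX, hY]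
    linear_combination (a * d - b * c) * h2
  have hBsm : ∀ (U : Set M) (X Y : ∀ x : M, Tan x), IsOpen U → SmoothField X U →
      SmoothField Y U → SmoothOn (fun x => pairing f η x (X x) (Y x)) U := fun U X Y hU hX hY =>
    (smoothOn_const (-6 : ℝ) U).mul
      ((vectorForm_smoothOn hs hU hX).mink (SmoothOn.der hU (hf.smoothOn U) hY))
  -- `J` was chosen point by point, so smoothness is obtained from `J X = Y` and `J Y = -X` on a
  -- smooth conformal frame.
  have hBJsm : ∀ (U : Set M) (X Y : ∀ x : M, Tan x), IsOpen U → SmoothField X U →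
      SmoothField Y U → SmoothOn (fun x => pairing f η x (J x (X x)) (Y x)) U := by
    intro U Z Z' hU hZ hZ'
    refine smoothOn_of_forall_exists fun x hx => ?_
    obtain ⟨V, X, Y, hxV, hV⟩ := hf.exists_conformalFrame o x
    have h := hV.mono (hV.isOpen.inter hU) Set.inter_subset_left
    have hZ'V := hZ'.mono (V := V ∩ U) Set.inter_subset_right
    obtain ⟨a, b, ha, hb, hab⟩ := h.exists_coeff hf (hZ.mono Set.inter_subset_right)
    refine ⟨V ∩ U, h.isOpen, ⟨hxV, hx⟩, SmoothOn.combination (X := X) (Y := Y)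
      (η := fun x => (pairing f η x).flip (Z' x) ∘ₗ J x) ?_ ?_ ha hb hab⟩
    · refine (hBsm _ Y Z' h.isOpen h.smooth_right hZ'V).congr fun y hy => ?_
      simp [(hJ y _ _ (h.pair y hy)).1]
    · refine ((smoothOn_const (-1 : ℝ) _).mul
        (hBsm _ X Z' h.isOpen h.smooth_left hZ'V)).congr fun y hy => ?_
      simp [(hJ y _ _ (h.pair y hy)).2]
  have hq : IsQuadraticDifferential o f (ofReal (pairing f η) J) := by
    refine ⟨fun U X Y hU hX hY => ?_, fun x v w => ?_, fun x X Y hp Z => ?_⟩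
    · refine ((SmoothOn.clm ((1 / 2 : ℂ) • Complex.ofRealCLM) (hBsm U X Y hU hX hY)).add
        (SmoothOn.clm ((-Complex.I / 2 : ℂ) • Complex.ofRealCLM) (hBJsm U X Y hU hX hY))).congr
        fun y _ => ?_
      rw [ofReal_apply]
      simp
      ring
    · rw [ofReal_apply, ofReal_apply, hBs x v w, hBJ x v w]
    · obtain ⟨hX, hY⟩ := hJ x X Y hp
      rw [ofReal_apply, ofReal_apply, hX, hY, map_neg, LinearMap.neg_apply]
      push_cast
      linear_combination ((1 / 2 : ℂ) * pairing f η x Y Z) * Complex.I_mul_I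
  refine ⟨_, hq, ?_⟩
  rw [associatedForm_eq]
  funext x
  apply LinearMap.ext
  intro v
  obtain ⟨X, Y, hp, -, -, hz⟩ := hB x
  obtain ⟨z, hz⟩ := hz v
  -- The factor `-6` in `pairing` cancels the `-1/6` of the Killing form. Tangentiality of `ω` is
  -- essential, since `Q` only sees the pairing of `ω` with `dF`.
  have hQ : quadEnd f (ofReal (pairing f η) J) x v = (-6 : ℝ) • z := by
    refine hf.eq_of_firstForm fun w => ?_
    rw [quadEnd_spec hf, ofReal_apply, map_smul, LinearMap.smul_apply, firstForm_apply, ← hz,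
      pairing_apply]
    simp
    ring
  rw [LinearMap.comp_apply, (vectorForm_spec hη x v).2.2, LinearMap.smul_apply, quadForm,
    LinearMap.comp_apply, hQ, map_smul, map_smul, map_smul, hz, smul_smul]
  norm_num

/-- The real part of `q` determines `q`: on a conformal pair, `Re q(X, Y) = -Im q(X, X)`, and `q(X,
X)` determines all other values. -/
theorem associatedForm_ne_zero_iff (hf : IsImmersion f) {q : BilinField M}
    (hq : IsQuadraticDifferential o f q) (x : M) : associatedForm f q x ≠ 0 ↔ q x ≠ 0 := by
  rw [not_iff_not]
  constructor
  · intro h0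
    have h1 : ∀ v w, (q x v w).re = 0 := fun v w => by
      have h2 : wedge (lift f x) (-(1 / 6 : ℝ) • quadForm f q x v) = 0 := by
        rw [associatedForm_eq] at h0
        exact LinearMap.congr_fun h0 v
      have h3 := eq_zero_of_wedge_eq_zero (lift_snd f x) (by simp [quadForm_snd hf]) h2
      have h4 : quadForm f q x v = 0 := by simpa using h3
      have h5 := mink_quadForm (q := q) hf x v w
      rw [h4, map_zero, LinearMap.zero_apply] at h5
      linarith
    obtain ⟨U, X, Y, hx, h⟩ := hf.exists_conformalFrame o x
    have hp := h.pair x hx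
    have h2 : q x (X x) (X x) = 0 := by
      have h3 := h1 (X x) (Y x)
      rw [hq.apply_left_right hp] at h3
      exact Complex.ext (h1 _ _) (by simpa using h3)
    apply LinearMap.ext
    intro v
    apply LinearMap.ext
    intro w
    obtain ⟨a, b, rfl⟩ := hp.1.exists_eq v
    obtain ⟨c, d, rfl⟩ := hp.1.exists_eq w
    simp [hq.apply_left_right hp, hq.apply_right_left hp, hq.apply_right_right hp, h2]
  · intro h0
    have h1 : quadForm f q x = 0 := by
      apply LinearMap.ext
      intro v
      have h2 : quadEnd f q x v = 0 := hf.eq_of_firstForm fun w => by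
        rw [quadEnd_spec hf, h0]
        simp
      rw [quadForm, LinearMap.comp_apply, h2, map_zero]
      rfl
    rw [associatedForm_eq]
    simp only [h1, smul_zero, LinearMap.comp_zero]

end Converse

end Isothermic

end

theorem mainTheorem6 {M : Type*} [TopologicalSpace M]
    [ChartedSpace (EuclideanSpace ℝ (Fin 2)) M] [IsManifold (𝓡 2) ∞ M]
    (o : Isothermic.SurfaceOrientation M) (f : M → Isothermic.ProjLightCone)
    (hf : Isothermic.IsImmersion f) :
    (Isothermic.IsIsothermic o f ↔
      ∃ η : Isothermic.OneForm M, η.IsSmooth ∧ (∃ x, η x ≠ 0) ∧ η.IsClosed ∧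
        η.TakesValuesInNilradical f) ∧
    (∀ q : Isothermic.BilinField M, Isothermic.IsQuadraticDifferential o f q →
      (Isothermic.associatedForm f q).IsSmooth ∧
      (Isothermic.associatedForm f q).TakesValuesInNilradical f ∧
      (Isothermic.IsHolomorphic o f q ∧ Isothermic.CommutesWithSecondForm f q ↔
        (Isothermic.associatedForm f q).IsClosed)) ∧
    (∀ η : Isothermic.OneForm M, η.IsSmooth → η.IsClosed → η.TakesValuesInNilradical f →
      ∃ q : Isothermic.BilinField M, Isothermic.IsQuadraticDifferential o f q ∧
        Isothermic.associatedForm f q = η) := by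
  refine ⟨⟨?_, ?_⟩, fun q hq => ⟨hq.isSmooth hf, Isothermic.associatedForm_mem hf q,
    hq.isClosed_iff hf⟩, fun η hs hc hη => Isothermic.exists_quadraticDifferential hf o hs hc hη⟩
  · rintro ⟨q, hq, ⟨x, hx⟩, hh⟩
    exact ⟨Isothermic.associatedForm f q, hq.isSmooth hf,
      ⟨x, (Isothermic.associatedForm_ne_zero_iff hf hq x).2 hx⟩, (hq.isClosed_iff hf).1 hh,
      Isothermic.associatedForm_mem hf q⟩
  · rintro ⟨η, hs, ⟨x, hx⟩, hc, hη⟩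
    obtain ⟨q, hq, rfl⟩ := Isothermic.exists_quadraticDifferential hf o hs hc hη
    exact ⟨q, hq, ⟨x, (Isothermic.associatedForm_ne_zero_iff hf hq x).1 hx⟩,
      (hq.isClosed_iff hf).2 hc⟩
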